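/- **Setting.** Let $L$ be a countable relational first-order language, $T$ a complete, model complete $L$-theory (model complete: every embedding between models of $T$ is elementary) and $N$ a countable model of $T$. An existential formula is one of the form $\exists\bar z\,\theta$ with $\theta$ quantifier-free. *Finite approximations.* Enumerate (each pair infinitely often) all pairs $\sigma_i=(\varphi_i(\bar x,\bar y),\alpha_i)$, $i<\omega$, of a quantifier-free $L$-formula with two finite tuples of variables and an ordinal $\alpha_i<\omega+\omega$. A structure $A$ with a chain of subsets $(V_\alpha^A)_{\alpha<\omega+\omega}$ ($V^A_\alpha\subseteq V^A_\beta$ for $\alpha\le\beta$) *strongly satisfies* $(\varphi(\bar x,\bar y),\alpha)$ if, for every tuple $\bar c$ from $V_\alpha^A$ such that $\exists\bar y\,\varphi(\bar c,\bar y)$ holds in some model of $T$ extending $A$, there is a tuple $\bar d$ from $V_{\alpha+1}^A$ with $A\models\varphi(\bar c,\bar d)$. Consider sequences $(A_n)_{n<\omega}$ of finite nonempty $L$-structures with such chains, each $A_n$ a substructure of a model of $T$ (equivalently a model of $T_\forall$), such that $A_n$ strongly satisfies $\sigma_i$ for all $i<n$. Let $\mathcal U$ be a nonprincipal ultrafilter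 on $\omega$, $A=\prod_{\mathcal U}A_n$, $V_\alpha^A=\prod_{\mathcal U}V_\alpha^{A_n}$, $V_{<\omega}^A=\bigcup_{n<\omega}V_n^A$, and let $c\mapsto c'$ be an elementary embedding $N\to V_{<\omega}^A$. *The dimension $\delta_N$.* Let $\mathbb R^*=\mathbb R^\omega/\mathcal U$, let $\mathcal C$ be the convex hull of $\mathbb Z$ in $\mathbb R^*$, and order $\mathbb R^*/\mathcal C$ by the order of $\mathbb R^*$. For an internal set $D=\prod_{\mathcal U}D_n\subseteq A^k$ let $|D|=(|D_n|)_n/\mathcal U\in\mathbb R^*$ and $\delta_A(D)=\log|D|+\mathcal C\in\mathbb R^*/\mathcal C$, with $\delta_A(\emptyset)=-\infty$. Every definable $X\subseteq N^k$ is defined by an existential formula $\varphi(\bar x,c)$ with parameters $c$ from $N$; put $\delta_N(X)=\delta_A\big(\{\bar x\in (V_\omega^A)^k: A\models\varphi(\bar x,c')\}\big)$, which depends only on $X$. *Quasidimensions.* A quasidimension on a structure $M$ with values in an ordered abelian group $G$ is a map $\delta$ from the sets definable in $M$ with parameters (in all finite powers of $M$) to $G\cup\{-\infty\}$ such that (1)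 $\delta(\emptyset)=-\infty$, and $\delta(X)>-\infty$ implies $\delta(X)\ge 0$; (2) $\delta(X\cup Y)=\max\{\delta(X),\delta(Y)\}$; (3) for every definable function $f:X\to Z$ and $\alpha\in G\cup\{-\infty\}$, if $\delta(f^{-1}(z))\le\alpha$ for all $z\in Z$, then $\delta(X)\le\alpha+\delta(Z)$. *Dividing.* $\varphi(x,b)$ divides over $a$ if in some elementary extension of $N$ there are realizations $(b_i)_{i<\omega}$ of $\operatorname{tp}(b/a)$ and an integer $r\ge1$ such that no $r$ of the formulas $\varphi(x,b_i)$ (with distinct indices) have a common solution. **Theorem.** Sequences, ultrafilters and embeddings as above exist. Moreover, for each choice of them, with $\delta_N$ the resulting dimension, the following holds. Let $\psi(x,a)$ and $\varphi(x,b)$ be existential $L$-formulas, where $x$ is a finite tuple of variables and $a,b$ are finite tuples from $N$, such that $\varphi(x,b)$ implies $\psi(x,a)$ in $N$, $\psi(x,a)$ is consistent (i.e. has a solution in $N$), and $\varphi(x,b)$ divides over $a$. Then there are an elementary extension $M$ of $N$, a quasidimension $\delta_M$ on $M$ with values in $\mathbb R^*/\mathcal C\cup\{-\infty\}$ that extends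 $\delta_N$ (that is, $\delta_M(\theta(M,c))=\delta_N(\theta(N,c))$ for every $L$-formula $\theta$ and every tuple $c$ from $N$), and a tuple $b^\#$ from $M$ with $b^\#\equiv_{a}b$ such that $$\delta_M(\varphi(x,b^\#))<\delta_M(\psi(x,a))=\delta_N(\psi(x,a)).$$ -/

import Mathlib

open FirstOrder Filter

universe u v w

namespace FineDimension

section Logic

variable {L : FirstOrder.Language.{u, v}}

/-- A theory is model complete if every embedding between models of it is elementary. -/
def IsModelComplete (T : L.Theory) : Prop :=
  ∀ (P Q : FirstOrder.Language.Theory.ModelType.{u, v, max u v} T) (f : P ↪[L] Q) (n : ℕ)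
    (χ : L.Formula (Fin n)) (x : Fin n → P), χ.Realize (f ∘ x) ↔ χ.Realize x

/-- The set `φ(P, c)` of solutions in `P` of the formula `φ(x, y)` with parameters `c` for `y`. -/
def solutionSet {P : Type*} [L.Structure P] {k m : ℕ} (φ : L.Formula (Fin k ⊕ Fin m))
    (c : Fin m → P) : Set (Fin k → P) :=
  {x | φ.Realize (Sum.elim x c)}

/-- `b' ≡_a b`, where `a, b` are tuples of `N`, `b'` is a tuple of the elementary extension
`j : N ↪ₑ[L] P`, and the types are computed in `P`. -/
def SameTypeOver {N P : Type*} [L.Structure N] [L.Structure P] (j : N ↪ₑ[L] P) {m l : ℕ}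
    (a : Fin m → N) (b' : Fin l → P) (b : Fin l → N) : Prop :=
  ∀ χ : L.Formula (Fin m ⊕ Fin l),
    χ.Realize (Sum.elim (j ∘ a) b') ↔ χ.Realize (Sum.elim (j ∘ a) (j ∘ b))

/-- `φ(x, b)` divides over `a`: in some elementary extension there are realizations
`s 0, s 1, …` of `tp(b/a)` such that `{φ(x, s i) : i ∈ ℕ}` is `r`-inconsistent for some `r`. -/
def Divides {N : Type w} [L.Structure N] {k m l : ℕ} (φ : L.Formula (Fin k ⊕ Fin l))
    (b : Fin l → N) (a : Fin m → N) : Prop :=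
  ∃ (P : Type w) (_ : L.Structure P) (j : N ↪ₑ[L] P) (s : ℕ → Fin l → P) (r : ℕ), 1 ≤ r ∧
    (∀ i, SameTypeOver j a (s i) b) ∧
    ∀ I : Finset ℕ, I.card = r → ¬ ∃ x : Fin k → P, ∀ i ∈ I, x ∈ solutionSet φ (s i)

/-- Quasidimensions on `M`, with values in `G ∪ {-∞}` for an ordered abelian group `G`
(`-∞` is `⊥`). Only the values on sets that are definable with parameters are constrained. -/
structure IsQuasidimension (L : FirstOrder.Language.{u, v}) (M : Type w) [L.Structure M] {G : Type*}
    [AddCommGroup G] [LinearOrder G] [IsOrderedAddMonoid G]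
    (δ : ∀ k : ℕ, Set (Fin k → M) → WithBot G) : Prop where
  empty : ∀ k, δ k ∅ = ⊥
  nonneg : ∀ k (X : Set (Fin k → M)), Set.univ.Definable L X → ⊥ < δ k X → 0 ≤ δ k X
  union : ∀ k (X Y : Set (Fin k → M)), Set.univ.Definable L X → Set.univ.Definable L Y →
    δ k (X ∪ Y) = max (δ k X) (δ k Y)
  fibre : ∀ (k l : ℕ) (X : Set (Fin k → M)) (Z : Set (Fin l → M)) (f : (Fin k → M) → (Fin l → M)),
    Set.univ.Definable L X → Set.univ.Definable L Z → Set.MapsTo f X Z →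
    Set.univ.Definable L {p : Fin k ⊕ Fin l → M | p ∘ Sum.inl ∈ X ∧ f (p ∘ Sum.inl) = p ∘ Sum.inr} →
    ∀ α : WithBot G, (∀ z ∈ Z, δ k {x ∈ X | f x = z} ≤ α) → δ k X ≤ α + δ l Z

end Logic

section ValueGroup

/-- The ultrapower `ℝ*` of the reals. -/
abbrev HyperReal (U : Ultrafilter ℕ) : Type := Filter.Germ (U : Filter ℕ) ℝ

/-- The convex hull `C` of `ℤ` in `ℝ*`. -/
def convexHullInt (U : Ultrafilter ℕ) : AddSubgroup (HyperReal U) where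
  carrier := {x | ∃ n : ℕ, |x| ≤ n}
  zero_mem' := ⟨0, by simp⟩
  add_mem' := by
    rintro x y ⟨n, hn⟩ ⟨m, hm⟩
    exact ⟨n + m, (abs_add_le x y).trans (by push_cast; exact add_le_add hn hm)⟩
  neg_mem' := by
    rintro x ⟨n, hn⟩
    exact ⟨n, by simpa using hn⟩

/-- The group `ℝ*/C`. -/
def FineGroup (U : Ultrafilter ℕ) : Type := HyperReal U ⧸ convexHullInt U

namespace FineGroup

variable {U : Ultrafilter ℕ}

noncomputable instance : AddCommGroup (FineGroup U) :=
  inferInstanceAs (AddCommGroup (HyperReal U ⧸ convexHullInt U))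

/-- The projection `ℝ* → ℝ*/C`. -/
def mk (x : HyperReal U) : FineGroup U := QuotientAddGroup.mk x

theorem mk_surjective : Function.Surjective (mk (U := U)) := QuotientAddGroup.mk_surjective

theorem mk_add (x y : HyperReal U) : mk (x + y) = mk x + mk y := rfl

theorem mk_eq_mk {x y : HyperReal U} : mk x = mk y ↔ ∃ n : ℕ, |-x + y| ≤ n :=
  QuotientAddGroup.eq

/-- The order induced from `ℝ*`. -/
instance : LE (FineGroup U) := ⟨fun p q => ∃ x y : HyperReal U, mk x = p ∧ mk y = q ∧ x ≤ y⟩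

theorem mk_le_mk {x y : HyperReal U} : mk x ≤ mk y ↔ ∃ n : ℕ, x ≤ y + n := by
  constructor
  · rintro ⟨x', y', hx, hy, h⟩
    obtain ⟨n, hn⟩ := mk_eq_mk.1 hx
    obtain ⟨m, hm⟩ := mk_eq_mk.1 hy
    refine ⟨n + m, ?_⟩
    have h1 := (abs_le.1 hn).2
    have h2 := (abs_le.1 hm).1
    push_cast
    linarith
  · rintro ⟨n, h⟩
    refine ⟨x, y + n, rfl, mk_eq_mk.2 ⟨n, ?_⟩, h⟩
    have : -(y + (n : HyperReal U)) + y = -(n : HyperReal U) := by ring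
    rw [this, abs_neg]
    exact (abs_of_nonneg (Nat.cast_nonneg n)).le

noncomputable instance : LinearOrder (FineGroup U) where
  le_refl p := by
    obtain ⟨x, rfl⟩ := mk_surjective p
    exact ⟨x, x, rfl, rfl, le_rfl⟩
  le_trans p q r := by
    obtain ⟨x, rfl⟩ := mk_surjective p
    obtain ⟨y, rfl⟩ := mk_surjective q
    obtain ⟨z, rfl⟩ := mk_surjective r
    simp only [mk_le_mk]
    rintro ⟨n, hn⟩ ⟨m, hm⟩
    exact ⟨m + n, by push_cast; linarith⟩
  le_antisymm p q := by
    obtain ⟨x, rfl⟩ := mk_surjective p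
    obtain ⟨y, rfl⟩ := mk_surjective q
    simp only [mk_le_mk, mk_eq_mk]
    rintro ⟨n, hn⟩ ⟨m, hm⟩
    have h1 : (0 : HyperReal U) ≤ n := Nat.cast_nonneg n
    have h2 : (0 : HyperReal U) ≤ m := Nat.cast_nonneg m
    exact ⟨n + m, abs_le.2 ⟨by push_cast; linarith, by push_cast; linarith⟩⟩
  le_total p q := by
    obtain ⟨x, rfl⟩ := mk_surjective p
    obtain ⟨y, rfl⟩ := mk_surjective q
    rcases le_total x y with h | h
    · exact .inl ⟨x, y, rfl, rfl, h⟩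
    · exact .inr ⟨y, x, rfl, rfl, h⟩
  toDecidableLE := Classical.decRel _

instance : IsOrderedAddMonoid (FineGroup U) where
  add_le_add_left p q := by
    rintro ⟨x, y, rfl, rfl, h⟩ r
    obtain ⟨z, rfl⟩ := mk_surjective r
    exact ⟨x + z, y + z, rfl, rfl, by linarith⟩

end FineGroup

end ValueGroup

section Construction

/-- The index set `ω + ω` of the predicates `V_α`. -/
abbrev Level : Type := ℕ ⊕ₗ ℕ

/-- The element `n` of `ω + ω`. -/
def Level.fin (n : ℕ) : Level := toLex (Sum.inl n)

/-- The element `ω + n` of `ω + ω`. -/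
def Level.inf (n : ℕ) : Level := toLex (Sum.inr n)

/-- The successor `α + 1` of `α`. -/
def Level.next (α : Level) : Level := toLex (Sum.map Nat.succ Nat.succ (ofLex α))

/-- Pairs `(φ(x, y), α)` of a quantifier-free formula with finite tuples of variables `x`, `y`
and an index `α < ω + ω`. -/
structure Task (L : FirstOrder.Language.{u, v}) where
  p : ℕ
  q : ℕ
  φ : L.Formula (Fin p ⊕ Fin q)
  isQF : φ.IsQF
  level : Level

variable {L : FirstOrder.Language.{u, v}}

/-- `A`, with the predicates `V_α` interpreted by `V`, strongly satisfies `(φ(x, y), α)`: if `c`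
is a tuple from `V_α` such that `∃ y, φ(c, y)` holds in some model of `T` extending `A`, then
`φ(c, d)` holds in `A` for some tuple `d` from `V_{α+1}`. -/
def StronglySatisfies (T : L.Theory) {A : Type} [L.Structure A] (V : Level → Set A)
    (t : Task L) : Prop :=
  ∀ c : Fin t.p → A, (∀ i, c i ∈ V t.level) →
    (∃ (P : FirstOrder.Language.Theory.ModelType.{u, v, max u v} T) (ι : A ↪[L] P) (d : Fin t.q → P),
      t.φ.Realize (Sum.elim (ι ∘ c) d)) →
    ∃ d : Fin t.q → A, (∀ i, d i ∈ V t.level.next) ∧ t.φ.Realize (Sum.elim c d)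

/-- A sequence of finite structures `A n`, each a model of the universal part of `T` (that is, a
substructure of a model of `T`), with a chain of subsets `V n α` (`α < ω + ω`), such that `A n`
strongly satisfies the first `n` pairs of an enumeration of all pairs `(φ(x, y), α)`. -/
structure FiniteApproximation (T : L.Theory) where
  A : ℕ → Type
  [str : ∀ n, L.Structure (A n)]
  [finite : ∀ n, Finite (A n)]
  [nonempty : ∀ n, Nonempty (A n)]
  V : ∀ n, Level → Set (A n)
  V_mono : ∀ n, Monotone (V n)
  task : ℕ → Task L
  task_infinite : ∀ t : Task L, {i | task i = t}.Infinite
  extends_to_model : ∀ n, ∃ P : FirstOrder.Language.Theory.ModelType.{u, v, max u v} T, Nonempty (A n ↪[L] P)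
  strong : ∀ n i, i < n → StronglySatisfies T (V n) (task i)

attribute [instance] FiniteApproximation.str FiniteApproximation.finite
  FiniteApproximation.nonempty

namespace FiniteApproximation

variable {T : L.Theory} (S : FiniteApproximation T) (U : Ultrafilter ℕ)

/-- The ultraproduct `M = ∏ A n / U`. -/
abbrev Ultra : Type := (U : Filter ℕ).Product S.A

/-- The interpretation `V_α^M` of `V_α` in the ultraproduct. -/
def ultraV (α : Level) : Set (S.Ultra U) :=
  {x | ∃ f : ∀ n, S.A n, (f : S.Ultra U) = x ∧ ∀ᶠ n in (U : Filter ℕ), f n ∈ S.V n α}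

/-- The substructure `V_{<ω}^M = ⋃ n, V_n^M` of `M`. -/
def belowOmega [L.IsRelational] : L.Substructure (S.Ultra U) where
  carrier := {x | ∃ n : ℕ, x ∈ S.ultraV U (Level.fin n)}
  fun_mem f := isEmptyElim f

/-- `D` is the internal subset of `M^k` given by the sequence `E n ⊆ (A n)^k`. -/
def IsInternalWith {k : ℕ} (D : Set (Fin k → S.Ultra U)) (E : ∀ n, Set (Fin k → S.A n)) : Prop :=
  ∀ f : Fin k → ∀ n, S.A n,
    (fun i => (f i : S.Ultra U)) ∈ D ↔ ∀ᶠ n in (U : Filter ℕ), (fun i => f i n) ∈ E n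

open Classical in
/-- The nonstandard cardinality `|D|` of an internal set (such as any definable set),
an element of `ℝ*`. -/
noncomputable def card {k : ℕ} (D : Set (Fin k → S.Ultra U)) : HyperReal U :=
  if h : ∃ E : ∀ n, Set (Fin k → S.A n), S.IsInternalWith U D E then
    ((fun n => ((h.choose n).ncard : ℝ) : ℕ → ℝ) : HyperReal U)
  else 0

open Classical in
/-- The fine pseudofinite dimension `δ_M(D) = log |D| + C`, with `δ_M(∅) = -∞`. -/
noncomputable def fineDim {k : ℕ} (D : Set (Fin k → S.Ultra U)) : WithBot (FineGroup U) :=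
  if D = ∅ then ⊥ else ((FineGroup.mk ((S.card U D).map Real.log) : FineGroup U) :
    WithBot (FineGroup U))

/-- `φ_ω(M, c)`: the solutions in `M` of `φ(x, c)` all of whose entries lie in `V_ω`. -/
def omegaSolutionSet {k m : ℕ} (φ : L.Formula (Fin k ⊕ Fin m)) (c : Fin m → S.Ultra U) :
    Set (Fin k → S.Ultra U) :=
  {x | (∀ i, x i ∈ S.ultraV U (Level.inf 0)) ∧ x ∈ solutionSet φ c}

end FiniteApproximation

/-- The data on which `δ_N` depends: a sequence of finite structures as above, a nonprincipal
ultrafilter, and an elementary embedding of `N` into `V_{<ω}` of the ultraproduct. -/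
structure PseudofiniteEmbedding [L.IsRelational] (T : L.Theory) (N : Type w) [L.Structure N] where
  approx : FiniteApproximation T
  U : Ultrafilter ℕ
  nonprincipal : (U : Filter ℕ) ≤ cofinite
  embed : N ↪ₑ[L] approx.belowOmega U

namespace PseudofiniteEmbedding

variable [L.IsRelational] {T : L.Theory} {N : Type w} [L.Structure N]
  (F : PseudofiniteEmbedding T N)

/-- An existential definition `φ(x, c)`, with parameters from `N`, of a subset of `N^k`. -/
structure ExistentialDefinition {k : ℕ} (X : Set (Fin k → N)) where
  m : ℕ
  φ : L.Formula (Fin k ⊕ Fin m)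
  isExistential : φ.IsExistential
  c : Fin m → N
  eq : X = solutionSet φ c

open Classical in
/-- `δ_N(X) = δ_M(φ_ω(x, c'))` for a set `X` defined in `N` by an existential formula `φ(x, c)`,
where `c'` is the image of `c` in the ultraproduct. For model complete `T` every definable set has
such a definition, and the value does not depend on it. -/
noncomputable def dim (k : ℕ) (X : Set (Fin k → N)) : WithBot (FineGroup F.U) :=
  if h : Nonempty (ExistentialDefinition (L := L) X) then
    F.approx.fineDim F.U
      (F.approx.omegaSolutionSet F.U h.some.φ (fun i => (F.embed (h.some.c i) : F.approx.Ultra F.U)))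
  else ⊥

end PseudofiniteEmbedding

end Construction

end FineDimension

/-! All counting is read in an ultrapower `M` of `N` that contains the ultraproduct. Since `T` is
complete, each `A n` maps injectively into `N` preserving any prescribed finite set of relations,
and a diagonal choice turns these maps into an embedding of the ultraproduct into `M`. Model
completeness makes the resulting map from `N` to `M` elementary, and strong satisfaction makes an
existential formula with parameters from `V_ω` have the same solutions from `V_ω` in the
ultraproduct and in `M`. So `δ_N` of a definable set is the logarithmic size of the trace on `V_ω`
of the corresponding subset of `M` (`dim_solutionSet`).

Dividing yields, for each constant `C`, many tuples of `N` that satisfy a given finite part of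
`tp(b/a)` and whose instances of `φ` are `r`-inconsistent. Moved to `M` and read in the `n`-th
factor, these instances become subsets of a finite set, the trace of `ψ(x, a)`, and averaging finds
one whose size is at most a fraction `1/C` of it. A diagonal choice over `C` gives a conjugate `b'`
of `b` for which the ratio exceeds every integer, so that the dimensions differ in `ℝ*/C`
(`exists_conjugate_fineDim_lt`).

It remains to extend the trace dimension from the sets definable over the countable set formed by
`N` and `b'` to all definable sets of `M`. A point receives, in essence, the infimum of the
dimensions of the sets over these parameters that contain it, and a definable set receives the
maximum over its points. Countable saturation of `ℝ*` provides the infima, and that of `M` shows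
that maxima are attained and that the old values are kept (`exists_pointwise_dimension`). The fibre
axiom needs no counting: a point of maximal dimension lies in some fibre, so that this fibre already
has the dimension of `X`, and `δ(Z) ≥ 0`.

For existence, finite subsets of `N` are closed finitely often under adding witnesses, for `∃ y,
φ(c, y)` if it holds in `N` and otherwise for its negation, which is equivalent to an existential
formula. The test of Tarski and Vaught then shows that `V_{<ω}` is elementary in an ultrapower of
`N`. -/

namespace FineDimension

/-! ### Model completeness and existential normal forms. -/

section ModelTheory

open FirstOrder.Language

variable {L : FirstOrder.Language.{u, v}}

theorem isQF_iInf {α β : Type*} [Finite β] {n : ℕ} (f : β → L.BoundedFormula α n)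
    (h : ∀ b, (f b).IsQF) : (BoundedFormula.iInf f).IsQF := by
  have key : ∀ l : List (L.BoundedFormula α n), (∀ χ ∈ l, χ.IsQF) →
      (l.foldr (· ⊓ ·) ⊤).IsQF := by
    intro l
    induction l with
    | nil => exact fun _ => BoundedFormula.IsQF.top
    | cons a l ih =>
      intro h
      exact (h a (by simp)).inf (ih fun χ hχ => h χ (by simp [hχ]))
  unfold BoundedFormula.iInf
  apply key
  simp only [List.mem_map]
  rintro χ ⟨b, -, rfl⟩
  exact h b

theorem realize_iff_of_isQF {α : Type*} {P Q : Type*} [L.Structure P] [L.Structure Q]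
    {θ : L.Formula α} (hθ : θ.IsQF) (f : P ↪[L] Q) (x : α → P) :
    θ.Realize (f ∘ x) ↔ θ.Realize x := by
  have := hθ.realize_embedding f (v := x) (xs := default)
  rwa [Subsingleton.elim (f ∘ (default : Fin 0 → P)) default] at this

/-- A set of formulas that is finitely satisfiable in models of `T` is satisfiable in one. -/
theorem exists_realize_of_finitely_satisfiable (T : L.Theory) {α : Type w} (Γ : Set (L.Formula α))
    (h : ∀ s : Finset (L.Formula α), (s : Set (L.Formula α)) ⊆ Γ →
      ∃ (P : Theory.ModelType.{u, v, max u v w} T) (x : α → P), ∀ χ ∈ s, χ.Realize x) :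
    ∃ (P : Theory.ModelType.{u, v, max u v w} T) (x : α → P), ∀ χ ∈ Γ, χ.Realize x := by
  classical
  have h' : ∀ s : Finset Γ, ∃ (P : Theory.ModelType.{u, v, max u v w} T) (x : α → P),
      ∀ χ ∈ s, χ.1.Realize x := by
    intro s
    obtain ⟨P, x, hx⟩ := h (s.map (Function.Embedding.subtype _)) (by simp)
    exact ⟨P, x, fun χ hχ => hx _ (by simpa using hχ)⟩
  choose P x hx using h'
  let W : Ultrafilter (Finset Γ) := Ultrafilter.of atTop
  let Q := (W : Filter (Finset Γ)).Product (fun s => (P s : Type max u v w))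
  have : Q ⊨ T := ⟨fun χ hχ => (Ultraproduct.sentence_realize χ).2
    (Eventually.of_forall fun s => Theory.realize_sentence_of_mem T hχ)⟩
  refine ⟨Theory.ModelType.of T Q, fun a => ((fun s => x s a : ∀ s, P s) : Q), fun χ hχ => ?_⟩
  refine (Ultraproduct.realize_formula_cast χ (fun a s => x s a)).2 ?_
  refine Eventually.filter_mono (Ultrafilter.of_le _) ?_
  filter_upwards [eventually_ge_atTop {⟨χ, hχ⟩}] with s hs
  exact hx s ⟨χ, hχ⟩ (hs (by simp))

/-- `∃ z, θ(x, z)` implies `χ(x)` in all models of `T`. -/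
def ImpliesIn (T : L.Theory) {n : ℕ} (χ : L.Formula (Fin n)) {q : ℕ}
    (θ : L.Formula (Fin n ⊕ Fin q)) : Prop :=
  ∀ (P : Theory.ModelType.{u, v, max u v} T) (x : Fin n → P) (z : Fin q → P),
    θ.Realize (Sum.elim x z) → χ.Realize x

theorem exists_isQF_realize_sup {n q r : ℕ} {θ : L.Formula (Fin n ⊕ Fin q)}
    {η : L.Formula (Fin n ⊕ Fin r)} (hθ : θ.IsQF) (hη : η.IsQF) :
    ∃ (s : ℕ) (ζ : L.Formula (Fin n ⊕ Fin s)), ζ.IsQF ∧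
      ∀ (P : Type (max u v)) [L.Structure P] [Nonempty P] (x : Fin n → P),
        (∃ z, ζ.Realize (Sum.elim x z)) ↔
          ((∃ z, θ.Realize (Sum.elim x z)) ∨ ∃ z, η.Realize (Sum.elim x z)) := by
  refine ⟨q + r, θ.relabel (Sum.map id (Fin.castAdd r)) ⊔ η.relabel (Sum.map id (Fin.natAdd q)),
    (hθ.relabel _).sup (hη.relabel _), fun P _ _ x => ?_⟩
  simp only [Formula.realize_sup, Formula.realize_relabel]
  constructor
  · rintro ⟨z, h | h⟩
    · exact .inl ⟨z ∘ Fin.castAdd r, by simpa [Sum.elim_comp_map] using h⟩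
    · exact .inr ⟨z ∘ Fin.natAdd q, by simpa [Sum.elim_comp_map] using h⟩
  · rintro (⟨z, h⟩ | ⟨z, h⟩)
    · refine ⟨Fin.append z (fun _ => Classical.arbitrary P), .inl ?_⟩
      have : Fin.append z (fun _ : Fin r => Classical.arbitrary P) ∘ Fin.castAdd r = z := by
        ext i; simp
      rwa [Sum.elim_comp_map, this]
    · refine ⟨Fin.append (fun _ => Classical.arbitrary P) z, .inr ?_⟩
      have : Fin.append (fun _ : Fin q => Classical.arbitrary P) z ∘ Fin.natAdd q = z := by
        ext i; simp
      rwa [Sum.elim_comp_map, this]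

/-- The quantifier-free type of a tuple that enumerates finitely many elements determines
which of the elements are equal. -/
theorem exists_isQF_eq_pattern {β : Type*} [Finite β] {P : Type*} (y : β → P) :
    ∃ θ : L.Formula β, θ.IsQF ∧ ∀ (Q : Type (max u v)) [L.Structure Q] (z : β → Q),
      θ.Realize z ↔ ∀ i j, y i = y j → z i = z j := by
  classical
  refine ⟨BoundedFormula.iInf (β := β × β) fun p => if y p.1 = y p.2 then
    ((Term.var p.1).equal (Term.var p.2) : L.Formula β) else ⊤, isQF_iInf _ fun p => ?_, ?_⟩
  · split_ifs
    · exact (BoundedFormula.IsAtomic.equal _ _).isQF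
    · exact BoundedFormula.IsQF.top
  · intro Q _ z
    simp only [Formula.Realize, BoundedFormula.realize_iInf, Prod.forall]
    refine forall₂_congr fun i j => ?_
    split_ifs with h
    · have : BoundedFormula.Realize ((Term.var i).equal (Term.var j) : L.Formula β) z default ↔
          z i = z j := Formula.realize_equal
      simp only [h, forall_const, this]
    · simp [h]

/-- In a model complete theory, a formula that holds of a tuple of a model is implied by an
existential formula that holds of it. -/
theorem exists_impliesIn_realize [L.IsRelational] {T : L.Theory} (hmc : IsModelComplete T) {n : ℕ}
    (χ : L.Formula (Fin n)) (P : Theory.ModelType.{u, v, max u v} T) (x : Fin n → P)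
    (hx : χ.Realize x) :
    ∃ (q : ℕ) (θ : L.Formula (Fin n ⊕ Fin q)), θ.IsQF ∧ ImpliesIn T χ θ ∧
      ∃ z, θ.Realize (Sum.elim x z) := by
  classical
  by_contra hcon
  push Not at hcon
  -- `Δ` is the quantifier-free diagram of `P`, with the elements of `P` as variables. A model of
  -- `Δ` and `¬χ(x)` would receive an embedding of `P` that does not preserve `χ`.
  let Δ : Set (L.Formula P) := {δ | ∃ (s : ℕ) (θ : L.Formula (Fin n ⊕ Fin s)) (f : Fin s → P),
    θ.IsQF ∧ θ.Realize (Sum.elim x f) ∧ δ = θ.relabel (Sum.elim x f)}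
  have hfin : ∀ F : Finset (L.Formula P), (F : Set (L.Formula P)) ⊆ Δ →
      ∃ (s : ℕ) (θ : L.Formula (Fin n ⊕ Fin s)) (f : Fin s → P), θ.IsQF ∧
        θ.Realize (Sum.elim x f) ∧ ∀ (Q : Theory.ModelType.{u, v, max u v} T) (g : P → Q),
          θ.Realize (g ∘ Sum.elim x f) → ∀ δ ∈ F, δ.Realize g := by
    intro F
    induction F using Finset.induction_on with
    | empty =>
      intro _
      exact ⟨0, ⊤, Fin.elim0, BoundedFormula.IsQF.top, by simp, by simp⟩
    | insert δ F hδ ih =>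
      intro hF
      rw [Finset.coe_insert, Set.insert_subset_iff] at hF
      obtain ⟨s, θ, f, hθ, hθx, himp⟩ := ih hF.2
      obtain ⟨s', θ', f', hθ', hθx', rfl⟩ := hF.1
      have e1 : (Sum.elim x (Fin.append f f') : Fin n ⊕ Fin (s + s') → P) ∘
          (Sum.map id (Fin.castAdd s')) = Sum.elim x f := by
        rw [Sum.elim_comp_map]; congr 1; ext i; simp
      have e2 : (Sum.elim x (Fin.append f f') : Fin n ⊕ Fin (s + s') → P) ∘
          (Sum.map id (Fin.natAdd s)) = Sum.elim x f' := by
        rw [Sum.elim_comp_map]; congr 1; ext i; simp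
      refine ⟨s + s', θ.relabel (Sum.map id (Fin.castAdd s')) ⊓
        θ'.relabel (Sum.map id (Fin.natAdd s)), Fin.append f f',
        (hθ.relabel _).inf (hθ'.relabel _), ?_, ?_⟩
      · rw [Formula.realize_inf, Formula.realize_relabel, Formula.realize_relabel, e1, e2]
        exact ⟨hθx, hθx'⟩
      · intro Q g
        rw [Formula.realize_inf, Formula.realize_relabel, Formula.realize_relabel,
          Function.comp_assoc, Function.comp_assoc, e1, e2]
        rintro ⟨h1, h2⟩ δ hδ
        rcases Finset.mem_insert.1 hδ with rfl | hδ
        · exact Formula.realize_relabel.2 h2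
        · exact himp Q g h1 δ hδ
  obtain ⟨Q, g, hg⟩ := exists_realize_of_finitely_satisfiable.{u, v, max u v} T
    (insert (χ.not.relabel x) Δ) (by
      intro F hF
      obtain ⟨s, θ, f, hθ, hθx, himp⟩ := hfin (F.erase (χ.not.relabel x)) (by
        intro δ hδ
        simp only [Finset.coe_erase, Set.mem_sdiff, Finset.mem_coe, Set.mem_singleton_iff] at hδ
        exact (hF hδ.1).resolve_left hδ.2)
      -- Different variables of `θ` may stand for the same element of `P`; `ε` forces them to have
      -- equal values, so that these values define a map on `P`.
      obtain ⟨ε, hε, hεz⟩ := exists_isQF_eq_pattern (L := L) (Sum.elim x f)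
      have hno : ¬ ImpliesIn T χ (θ ⊓ ε) := fun himp' =>
        hcon s (θ ⊓ ε) (hθ.inf hε) himp' f
          (Formula.realize_inf.2 ⟨hθx, (hεz P _).2 fun _ _ h => h⟩)
      unfold ImpliesIn at hno
      push Not at hno
      obtain ⟨Q, y, z, hyz, hy⟩ := hno
      obtain ⟨h1, h2⟩ := Formula.realize_inf.1 hyz
      rw [hεz] at h2
      let g : P → Q := fun p => if h : ∃ i, Sum.elim x f i = p then Sum.elim y z h.choose
        else Classical.arbitrary Q
      have hgi : g ∘ Sum.elim x f = Sum.elim y z := by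
        ext i
        have hi : ∃ i', Sum.elim x f i' = Sum.elim x f i := ⟨i, rfl⟩
        simp only [Function.comp, g, dif_pos hi]
        exact h2 _ _ hi.choose_spec
      refine ⟨Q, g, fun δ hδ => ?_⟩
      by_cases hδ' : δ = χ.not.relabel x
      · rw [hδ', Formula.realize_relabel, Formula.realize_not]
        have : g ∘ x = y := by
          have := congrArg (· ∘ Sum.inl) hgi
          simpa [Function.comp_assoc] using this
        rwa [this]
      · exact himp Q g (by rwa [hgi]) δ (Finset.mem_erase.2 ⟨hδ', hδ⟩))
  have hqf : ∀ (s : ℕ) (θ : L.Formula (Fin s)) (f : Fin s → P), θ.IsQF → θ.Realize f →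
      θ.Realize (g ∘ f) := by
    intro s θ f hθ hf
    have := hg ((θ.relabel Sum.inr).relabel (Sum.elim x f)) (Or.inr ⟨s, θ.relabel Sum.inr, f,
      hθ.relabel _, by simpa [Formula.realize_relabel] using hf, rfl⟩)
    simpa [Formula.realize_relabel, Function.comp_assoc] using this
  let G : P ↪[L] Q :=
    { toFun := g
      inj' := by
        intro p p' hpp
        by_contra hne
        have := hqf 2 ((Term.var 0).equal (Term.var 1)).not ![p, p']
          (BoundedFormula.IsAtomic.equal _ _).isQF.not (by
            rw [Formula.realize_not, Formula.realize_equal]; simpa using hne)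
        rw [Formula.realize_not, Formula.realize_equal] at this
        exact this (by simpa using hpp)
      map_fun' := fun f => isEmptyElim f
      map_rel' := by
        intro s r f
        constructor
        · intro h
          by_contra hne
          have := hqf s (r.formula Term.var).not f
            (BoundedFormula.IsAtomic.rel _ _).isQF.not (by
              rw [Formula.realize_not, Formula.realize_rel]; simpa using hne)
          rw [Formula.realize_not, Formula.realize_rel] at this
          exact this h
        · intro h
          have := hqf s (r.formula Term.var) f
            (BoundedFormula.IsAtomic.rel _ _).isQF (by rw [Formula.realize_rel]; simpa using h)
          rw [Formula.realize_rel] at this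
          exact this }
  have h1 : ¬ χ.Realize (g ∘ x) := by
    have := hg _ (Set.mem_insert _ _)
    rwa [Formula.realize_relabel, Formula.realize_not] at this
  exact h1 ((hmc P Q G n χ x).2 hx)

/-- The case of formulas in the variables `x 0, …, x (n - 1)`. -/
theorem exists_isQF_of_isModelComplete_fin [L.IsRelational] {T : L.Theory}
    (hmc : IsModelComplete T) {n : ℕ} (χ : L.Formula (Fin n)) :
    ∃ (q : ℕ) (θ : L.Formula (Fin n ⊕ Fin q)), θ.IsQF ∧
      ∀ (P : Theory.ModelType.{u, v, max u v} T) (x : Fin n → P),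
        χ.Realize x ↔ ∃ z, θ.Realize (Sum.elim x z) := by
  classical
  let Γ : Set (L.Formula (Fin n)) := {δ | ∃ (q : ℕ) (θ : L.Formula (Fin n ⊕ Fin q)),
    θ.IsQF ∧ ImpliesIn T χ θ ∧ δ = (θ.iExs (Fin q)).not}
  have hfin : ∀ F : Finset (L.Formula (Fin n)), (F : Set (L.Formula (Fin n))) ⊆ Γ →
      ∃ (q : ℕ) (θ : L.Formula (Fin n ⊕ Fin q)), θ.IsQF ∧ ImpliesIn T χ θ ∧
        ∀ (P : Theory.ModelType.{u, v, max u v} T) (x : Fin n → P),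
          (¬ ∃ z, θ.Realize (Sum.elim x z)) → ∀ δ ∈ F, δ.Realize x := by
    intro F
    induction F using Finset.induction_on with
    | empty =>
      intro _
      exact ⟨0, ⊥, BoundedFormula.isQF_bot, fun P x z h => by simp at h, by simp⟩
    | insert δ F hδ ih =>
      intro hF
      rw [Finset.coe_insert, Set.insert_subset_iff] at hF
      obtain ⟨q, θ, hθ, hθi, himp⟩ := ih hF.2
      obtain ⟨q', θ', hθ', hθi', rfl⟩ := hF.1
      obtain ⟨s, ζ, hζ, hζr⟩ := exists_isQF_realize_sup hθ hθ'
      refine ⟨s, ζ, hζ, fun P x z hz => ?_, fun P x hx δ hδ => ?_⟩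
      · rcases (hζr P x).1 ⟨z, hz⟩ with ⟨z, h⟩ | ⟨z, h⟩
        exacts [hθi P x z h, hθi' P x z h]
      · rw [hζr P x, not_or] at hx
        rcases Finset.mem_insert.1 hδ with rfl | hδ
        · rw [Formula.realize_not, Formula.realize_iExs]
          exact hx.2
        · exact himp P x hx.1 δ hδ
  -- If no existential formula were equivalent to `χ`, then `χ` would be consistent with the
  -- negations of all existential formulas that imply it, against `exists_impliesIn_realize`.
  by_contra hcon
  push Not at hcon
  obtain ⟨P, x, hx⟩ := exists_realize_of_finitely_satisfiable.{u, v, 0} T (insert χ Γ) (by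
    intro F hF
    obtain ⟨q, θ, hθ, hθi, himp⟩ := hfin (F.erase χ) (by
      intro δ hδ
      simp only [Finset.coe_erase, Set.mem_sdiff, Finset.mem_coe, Set.mem_singleton_iff] at hδ
      exact (hF hδ.1).resolve_left hδ.2)
    obtain ⟨P, x, h⟩ := hcon q θ hθ
    rcases h with h | ⟨h, z, hz⟩
    · refine ⟨P, x, fun δ hδ => ?_⟩
      by_cases hδ' : δ = χ
      · exact hδ' ▸ h.1
      · exact himp P x (by simpa using h.2) δ (Finset.mem_erase.2 ⟨hδ', hδ⟩)
    · exact absurd (hθi P x z hz) h)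
  obtain ⟨q, θ, hθ, hθi, hz⟩ := exists_impliesIn_realize hmc χ P x (hx _ (Set.mem_insert _ _))
  have := hx _ (Set.mem_insert_of_mem _ ⟨q, θ, hθ, hθi, rfl⟩)
  rw [Formula.realize_not, Formula.realize_iExs] at this
  exact this hz

theorem realize_iff_exists_of_models {T : L.Theory} {β : Type*} {χ : L.Formula β} {q : ℕ}
    {θ : L.Formula (β ⊕ Fin q)} (h : T ⊨ᵇ χ.iff (θ.iExs (Fin q))) (P : Type*) [L.Structure P]
    [P ⊨ T] [Nonempty P] (x : β → P) : χ.Realize x ↔ ∃ z, θ.Realize (Sum.elim x z) := by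
  have := h.realize_formula P (v := x)
  rwa [Formula.realize_iff, Formula.realize_iExs] at this

/-- In a model complete theory every formula is equivalent to a formula `∃ z, θ(x, z)` with
quantifier-free `θ`. -/
theorem exists_isQF_of_isModelComplete [L.IsRelational] {T : L.Theory}
    (hmc : IsModelComplete T) {β : Type*} [Finite β] (χ : L.Formula β) :
    ∃ (q : ℕ) (θ : L.Formula (β ⊕ Fin q)), θ.IsQF ∧ T ⊨ᵇ χ.iff (θ.iExs (Fin q)) := by
  obtain ⟨n, ⟨e⟩⟩ := Finite.exists_equiv_fin β
  obtain ⟨q, θ, hθ, h⟩ := exists_isQF_of_isModelComplete_fin hmc (χ.relabel e)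
  refine ⟨q, θ.relabel (Sum.map e.symm id), hθ.relabel _, ?_⟩
  rw [Theory.models_formula_iff]
  intro P x
  have hT : T ⊨ᵇ (χ.relabel e).iff (θ.iExs (Fin q)) := by
    rw [Theory.models_formula_iff]
    intro P y
    rw [Formula.realize_iff, h P, Formula.realize_iExs]
  have := realize_iff_exists_of_models hT P (x ∘ e.symm)
  rw [Formula.realize_relabel] at this
  simp only [Function.comp_assoc, Equiv.symm_comp_self, Function.comp_id] at this
  rw [Formula.realize_iff, Formula.realize_iExs, this]
  simp [Formula.realize_relabel, Sum.elim_comp_map]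

/-- The normal form `∃ z, θ(x, z)` of an existential formula. -/
theorem exists_isQF_of_isExistential {β : Type w} {χ : L.Formula β} (hχ : χ.IsExistential) :
    ∃ (q : ℕ) (θ : L.Formula (β ⊕ Fin q)), θ.IsQF ∧
      (∅ : L.Theory) ⊨ᵇ χ.iff (θ.iExs (Fin q)) := by
  have key : ∀ (n : ℕ) (χ : L.BoundedFormula β n), χ.IsExistential →
      ∃ (q : ℕ) (θ : L.BoundedFormula β q), θ.IsQF ∧
        ∀ (P : Type (max u v w)) [L.Structure P] (x : β → P),
          (∃ xs, χ.Realize x xs) ↔ ∃ z, θ.Realize x z := by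
    intro n χ h
    induction h with
    | @of_isQF n χ h => exact ⟨n, χ, h, fun P _ x => Iff.rfl⟩
    | @ex n χ h ih =>
      obtain ⟨q, θ, hθ, hr⟩ := ih
      refine ⟨q, θ, hθ, fun P _ x => ?_⟩
      rw [← hr]
      simp only [BoundedFormula.realize_ex]
      constructor
      · rintro ⟨xs, a, h⟩
        exact ⟨_, h⟩
      · rintro ⟨xs, h⟩
        exact ⟨Fin.init xs, xs (Fin.last _), by rwa [Fin.snoc_init_self]⟩
  obtain ⟨q, θ, hθ, h⟩ := key 0 χ hχ
  refine ⟨q, θ.toFormula, ?_, Theory.models_formula_iff.2 fun P x => ?_⟩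
  · clear h
    induction hθ with
    | falsum => exact BoundedFormula.IsQF.falsum
    | of_isAtomic h =>
      cases h with
      | equal t₁ t₂ => exact (BoundedFormula.IsAtomic.equal _ _).isQF
      | rel R ts => exact (BoundedFormula.IsAtomic.rel _ _).isQF
    | imp _ _ h1 h2 => exact h1.imp h2
  · rw [Formula.realize_iff, Formula.realize_iExs]
    simp only [BoundedFormula.realize_toFormula, Sum.elim_comp_inl, Sum.elim_comp_inr]
    rw [← h]
    exact ⟨fun h => ⟨default, h⟩, fun ⟨xs, h⟩ => by
      rwa [Subsingleton.elim xs default] at h⟩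

theorem isExistential_exs {β : Type*} {q : ℕ} {θ : L.BoundedFormula β q} (hθ : θ.IsExistential) :
    θ.exs.IsExistential := by
  induction q with
  | zero => exact hθ
  | succ n ih => exact ih hθ.ex

/-- In a model complete theory every formula is equivalent to an existential one. -/
theorem exists_isExistential_of_isModelComplete [L.IsRelational] {T : L.Theory}
    (hmc : IsModelComplete T) {β : Type*} [Finite β] (χ : L.Formula β) :
    ∃ χ' : L.Formula β, χ'.IsExistential ∧
      ∀ (P : Type w) [L.Structure P] [P ⊨ T] [Nonempty P] (x : β → P),
        χ'.Realize x ↔ χ.Realize x := by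
  obtain ⟨q, θ, hθ, h⟩ := exists_isQF_of_isModelComplete hmc χ
  refine ⟨BoundedFormula.exs (BoundedFormula.relabel (id : β ⊕ Fin q → β ⊕ Fin q) θ),
    isExistential_exs (hθ.relabel _).isExistential, fun P _ _ _ x => ?_⟩
  rw [realize_iff_exists_of_models h P x, BoundedFormula.realize_exs]
  refine exists_congr fun z => ?_
  rw [BoundedFormula.realize_relabel, Formula.Realize]
  simp only [Function.comp_id, Fin.castAdd_zero]
  exact iff_of_eq (congrArg _ (Subsingleton.elim _ _))

end ModelTheory

section ModelTheory

open FirstOrder.Language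

variable {L : FirstOrder.Language.{u, v}}

/-- Embeddings between models of a model complete theory are elementary, in all universes. -/
theorem realize_comp_iff_of_isModelComplete [L.IsRelational] {T : L.Theory}
    (hmc : IsModelComplete T) {P Q : Type*} [L.Structure P] [L.Structure Q] [P ⊨ T] [Q ⊨ T]
    [Nonempty P] [Nonempty Q] (f : P ↪[L] Q) {β : Type*} [Finite β] (χ : L.Formula β)
    (x : β → P) : χ.Realize (f ∘ x) ↔ χ.Realize x := by
  -- Existential formulas pass to extensions; the converse is this statement for `¬χ`.
  have key : ∀ χ : L.Formula β, χ.Realize x → χ.Realize (f ∘ x) := by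
    intro χ h
    obtain ⟨q, θ, hθ, hT⟩ := exists_isQF_of_isModelComplete hmc χ
    obtain ⟨z, hz⟩ := (realize_iff_exists_of_models hT P x).1 h
    refine (realize_iff_exists_of_models hT Q _).2 ⟨f ∘ z, ?_⟩
    rw [← Sum.comp_elim]
    exact (realize_iff_of_isQF hθ f _).2 hz
  refine ⟨fun h => ?_, key χ⟩
  by_contra hn
  exact Formula.realize_not.1 (key χ.not (Formula.realize_not.2 hn)) h

/-- An embedding between models of a model complete theory, as an elementary embedding. -/
def elementaryOfIsModelComplete [L.IsRelational] {T : L.Theory}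
    (hmc : IsModelComplete T) {P Q : Type*} [L.Structure P] [L.Structure Q] [P ⊨ T] [Q ⊨ T]
    [Nonempty P] [Nonempty Q] (f : P ↪[L] Q) : P ↪ₑ[L] Q where
  toFun := f
  map_formula' _ χ x := realize_comp_iff_of_isModelComplete hmc f χ x

end ModelTheory

/-! ### Countable saturation, infima in `ℝ*/C`, and dimensions of points. -/

section Diagonal

/-- Countable saturation of ultraproducts over `ℕ`. -/
theorem exists_diagonal {U : Ultrafilter ℕ} (hU : (U : Filter ℕ) ≤ cofinite) {β : ℕ → Type*}
    (Q : ℕ → ∀ n, β n → Prop)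
    (h : ∀ C, ∃ b : ∀ n, β n, ∀ᶠ n in (U : Filter ℕ), ∀ i ≤ C, Q i n (b n)) :
    ∃ b : ∀ n, β n, ∀ i, ∀ᶠ n in (U : Filter ℕ), Q i n (b n) := by
  classical
  choose b hb using h
  -- At `n`, use the approximation with the largest index `C ≤ n` whose conditions up to `C` all
  -- hold at `n`. Since `U` is nonprincipal, this index is at least `i` for almost all `n`.
  refine ⟨fun n => b (Nat.findGreatest (fun C => ∀ i ≤ C, Q i n (b C n)) n) n, fun i => ?_⟩
  have hge : ∀ᶠ n in (U : Filter ℕ), i ≤ n := by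
    rw [Nat.cofinite_eq_atTop] at hU
    exact hU (eventually_ge_atTop i)
  filter_upwards [hb i, hge] with n hn hin
  exact Nat.findGreatest_spec (P := fun C => ∀ i ≤ C, Q i n (b C n)) hin hn i
    (Nat.le_findGreatest (P := fun C => ∀ i ≤ C, Q i n (b C n)) hin hn)

theorem FineGroup.lt_of_mk_lt_mk {U : Ultrafilter ℕ} {x y : HyperReal U}
    (h : FineGroup.mk x < FineGroup.mk y) : x < y := by
  by_contra hn
  exact absurd (FineGroup.mk_le_mk.2 ⟨0, by simpa using hn⟩) (not_le.2 h)

theorem FineGroup.mk_le_mk_of_le {U : Ultrafilter ℕ} {x y : HyperReal U}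
    (h : x ≤ y) : FineGroup.mk x ≤ FineGroup.mk y := ⟨x, y, rfl, rfl, h⟩

/-- Strict inequalities in the quotient give inequalities between representatives. A finite maximum
of lower representatives interpolates finitely many conditions, and saturation of `ℝ*` handles all
of them. -/
theorem FineGroup.exists_between_of_countable {U : Ultrafilter ℕ}
    (hU : (U : Filter ℕ) ≤ cofinite) (a c : ℕ → FineGroup U) (h : ∀ i j, a i < c j) :
    ∃ g, ∀ i, a i ≤ g ∧ g ≤ c i := by
  have hrep : ∀ p : FineGroup U, ∃ f : ℕ → ℝ, FineGroup.mk (f : HyperReal U) = p := by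
    intro p
    obtain ⟨x, rfl⟩ := FineGroup.mk_surjective p
    induction x using Filter.Germ.inductionOn with
    | h f => exact ⟨f, rfl⟩
  choose α hα using fun i => hrep (a i)
  choose γ hγ using fun i => hrep (c i)
  have hlt : ∀ i j, ∀ᶠ n in (U : Filter ℕ), α i n ≤ γ j n := by
    intro i j
    have := h i j
    rw [← hα i, ← hγ j] at this
    exact Germ.coe_le.1 (FineGroup.lt_of_mk_lt_mk this).le
  obtain ⟨b, hb⟩ := exists_diagonal hU (β := fun _ => ℝ)
    (fun i n x => α i n ≤ x ∧ x ≤ γ i n) (fun C => by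
      refine ⟨fun n => (Finset.range (C + 1)).sup' ⟨0, by simp⟩ (fun i => α i n), ?_⟩
      have : ∀ᶠ n in (U : Filter ℕ), ∀ i ∈ Finset.range (C + 1), ∀ j ∈ Finset.range (C + 1),
          α i n ≤ γ j n := by
        simp only [Filter.eventually_all_finset]
        exact fun i _ j _ => hlt i j
      filter_upwards [this] with n hn i hi
      have hi' : i ∈ Finset.range (C + 1) := by simp; omega
      exact ⟨Finset.le_sup' (fun i => α i n) hi', Finset.sup'_le _ _ fun j hj => hn j hj i hi'⟩)
  refine ⟨FineGroup.mk (b : HyperReal U), fun i => ⟨?_, ?_⟩⟩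
  · rw [← hα i]
    exact FineGroup.mk_le_mk_of_le (Germ.coe_le.2 ((hb i).mono fun n h => h.1))
  · rw [← hγ i]
    exact FineGroup.mk_le_mk_of_le (Germ.coe_le.2 ((hb i).mono fun n h => h.2))

/-- Infima of subsets of `ℝ*/C` exist relative to a countable set of values. -/
theorem FineGroup.exists_relative_inf {U : Ultrafilter ℕ} (hU : (U : Filter ℕ) ≤ cofinite)
    (Γ : Set (WithBot (FineGroup U))) (hΓ : Γ.Countable) (W : Set (WithBot (FineGroup U)))
    (hW : W ⊆ Γ) (hne : W.Nonempty) :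
    ∃ g, (∀ x ∈ W, g ≤ x) ∧ ∀ γ ∈ Γ, (∀ x ∈ W, γ ≤ x) → γ ≤ g := by
  by_cases hmin : ∃ g ∈ W, ∀ x ∈ W, g ≤ x
  · obtain ⟨g, hg, h⟩ := hmin
    exact ⟨g, h, fun γ _ hγ => hγ g hg⟩
  push Not at hmin
  by_cases hA : ∃ γ : FineGroup U, (γ : WithBot (FineGroup U)) ∈ Γ ∧
      ∀ x ∈ W, (γ : WithBot (FineGroup U)) ≤ x
  · let A : Set (FineGroup U) := {γ | (γ : WithBot (FineGroup U)) ∈ Γ ∧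
      ∀ x ∈ W, (γ : WithBot (FineGroup U)) ≤ x}
    let W' : Set (FineGroup U) := {γ | (γ : WithBot (FineGroup U)) ∈ W}
    have hbot : ∀ x ∈ W, x ≠ ⊥ := by
      rintro x hx rfl
      obtain ⟨y, _, hy⟩ := hmin _ hx
      exact not_lt_bot hy
    have hAc : A.Countable :=
      (hΓ.preimage WithBot.coe_injective).mono fun γ hγ => hγ.1
    have hWc : W'.Countable :=
      (hΓ.preimage WithBot.coe_injective).mono fun γ hγ => hW hγ
    obtain ⟨a, ha⟩ := hAc.exists_eq_range hA
    obtain ⟨c, hc⟩ := hWc.exists_eq_range (by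
      obtain ⟨x, hx⟩ := hne
      obtain ⟨y, rfl⟩ := WithBot.ne_bot_iff_exists.1 (hbot x hx)
      exact ⟨y, hx⟩)
    have haA : ∀ i, a i ∈ A := fun i => ha ▸ Set.mem_range_self i
    have hcW : ∀ i, c i ∈ W' := fun i => hc ▸ Set.mem_range_self i
    obtain ⟨g, hg⟩ := FineGroup.exists_between_of_countable hU a c (fun i j => by
      -- `W` has no least element here, so its lower bounds lie strictly below each of its elements.
      obtain ⟨y, hy, hyj⟩ := hmin _ (hcW j)
      exact WithBot.coe_lt_coe.1 (((haA i).2 y hy).trans_lt hyj))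
    refine ⟨g, fun x hx => ?_, fun γ hγ hγW => ?_⟩
    · obtain ⟨y, rfl⟩ := WithBot.ne_bot_iff_exists.1 (hbot x hx)
      have : y ∈ Set.range c := hc ▸ hx
      obtain ⟨i, rfl⟩ := this
      exact WithBot.coe_le_coe.2 (hg i).2
    · rcases eq_or_ne γ ⊥ with rfl | hb
      · exact bot_le
      · obtain ⟨y, rfl⟩ := WithBot.ne_bot_iff_exists.1 hb
        have : y ∈ Set.range a := ha ▸ (show y ∈ A from ⟨hγ, hγW⟩)
        obtain ⟨i, rfl⟩ := this
        exact WithBot.coe_le_coe.2 (hg i).1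
  · push Not at hA
    refine ⟨⊥, fun x _ => bot_le, fun γ hγ hγW => ?_⟩
    rcases eq_or_ne γ ⊥ with rfl | hb
    · exact le_rfl
    · obtain ⟨y, rfl⟩ := WithBot.ne_bot_iff_exists.1 hb
      obtain ⟨x, hx, hlt⟩ := hA y hγ
      exact absurd (hγW x hx) (not_le.2 hlt)

/-- A dimension `ν` on a countable family `ℬ` of subsets of `E` gives a dimension `d p` of points:
essentially the infimum of `ν B` over all `B ∈ ℬ` that contain `p`. In the presence of countable
saturation, the maximum of `d` over a set of `𝒟` is attained, and equals `ν B` for `B ∈ ℬ`. -/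
theorem exists_pointwise_dimension {E R : Type*} [LinearOrder R] {z : R}
    (hinf : ∀ Γ : Set R, Γ.Countable → ∀ W ⊆ Γ, W.Nonempty →
      ∃ g, (∀ x ∈ W, g ≤ x) ∧ ∀ γ ∈ Γ, (∀ x ∈ W, γ ≤ x) → γ ≤ g)
    {ℬ 𝒟 : Set (Set E)} (hℬ : ℬ.Countable) (huniv : Set.univ ∈ ℬ) (hsub : ℬ ⊆ 𝒟) (ν : Set E → R)
    (hz : ∀ B ∈ ℬ, B.Nonempty → z ≤ ν B)
    (hcov : ∀ B ∈ ℬ, B.Nonempty → ∀ F : Finset (Set E),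
      (∀ B' ∈ F, B' ∈ ℬ ∧ ν B' < ν B) → ¬ B ⊆ ⋃₀ F)
    (hsat : ∀ X ∈ 𝒟, ∀ 𝓕 ⊆ ℬ, (∀ F : Finset (Set E), (F : Set (Set E)) ⊆ 𝓕 → ¬ X ⊆ ⋃₀ F) →
      ¬ X ⊆ ⋃₀ 𝓕) :
    ∃ d : E → R, (∀ p, z ≤ d p) ∧ (∀ X ∈ 𝒟, X.Nonempty → ∃ p ∈ X, ∀ q ∈ X, d q ≤ d p) ∧
      ∀ B ∈ ℬ, B.Nonempty → (∀ p ∈ B, d p ≤ ν B) ∧ ∃ p ∈ B, d p = ν B := by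
  classical
  let Γ : Set R := insert z (ν '' ℬ)
  have hΓ : Γ.Countable := (hℬ.image ν).insert z
  have he : ∀ W : Set R, ∃ g, W ⊆ Γ → W.Nonempty →
      (∀ x ∈ W, g ≤ x) ∧ ∀ γ ∈ Γ, (∀ x ∈ W, γ ≤ x) → γ ≤ g := by
    intro W
    by_cases h : W ⊆ Γ ∧ W.Nonempty
    · obtain ⟨g, hg⟩ := hinf Γ hΓ W h.1 h.2
      exact ⟨g, fun _ _ => hg⟩
    · exact ⟨z, fun h1 h2 => absurd ⟨h1, h2⟩ h⟩
  choose e he using he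
  -- The sets `W p` are closed upwards in `Γ`, hence comparable by inclusion. As `e` is only a
  -- choice of relative infima, its monotonicity on these sets has to be derived from this
  -- comparison.
  let W : E → Set R := fun p => {g ∈ Γ | ∃ B ∈ ℬ, p ∈ B ∧ ν B ≤ g}
  have hWΓ : ∀ p, W p ⊆ Γ := fun p g hg => hg.1
  have hνW : ∀ p, ∀ B ∈ ℬ, p ∈ B → ν B ∈ W p := fun p B hB hp =>
    ⟨Set.mem_insert_of_mem _ ⟨B, hB, rfl⟩, B, hB, hp, le_rfl⟩
  have hWne : ∀ p, (W p).Nonempty := fun p => ⟨_, hνW p _ huniv (Set.mem_univ p)⟩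
  have hlow : ∀ p, ∀ γ ∈ Γ, (∀ B ∈ ℬ, p ∈ B → γ ≤ ν B) → γ ≤ e (W p) := by
    intro p γ hγ h
    refine (he (W p) (hWΓ p) (hWne p)).2 γ hγ ?_
    rintro x ⟨-, B, hB, hp, hx⟩
    exact (h B hB hp).trans hx
  have hup : ∀ p, ∀ B ∈ ℬ, p ∈ B → e (W p) ≤ ν B := fun p B hB hp =>
    (he (W p) (hWΓ p) (hWne p)).1 _ (hνW p B hB hp)
  have hmono : ∀ p q, (∀ B ∈ ℬ, p ∈ B → ∃ B' ∈ ℬ, q ∈ B' ∧ ν B' ≤ ν B) → e (W q) ≤ e (W p) := by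
    intro p q h
    have hpq : W p ⊆ W q := by
      rintro g ⟨hg, B, hB, hp, hle⟩
      obtain ⟨B', hB', hq, hle'⟩ := h B hB hp
      exact ⟨hg, B', hB', hq, hle'.trans hle⟩
    by_cases hqp : W q ⊆ W p
    · rw [hpq.antisymm hqp]
    · obtain ⟨γ, hγq, hγp⟩ := Set.not_subset.1 hqp
      refine ((he (W q) (hWΓ q) (hWne q)).1 γ hγq).trans (hlow p γ (hWΓ q hγq) ?_)
      intro B hB hp
      by_contra hlt
      exact hγp ⟨hWΓ q hγq, B, hB, hp, (not_le.1 hlt).le⟩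
  refine ⟨fun p => e (W p), fun p => hlow p z (Set.mem_insert _ _) fun B hB hp => hz B hB ⟨p, hp⟩,
    fun X hX hXne => ?_, fun B hB hBne => ⟨fun p hp => hup p B hB hp, ?_⟩⟩
  -- `Λ` consists of the `g` for which some point of `X` lies only in sets of value above `g`. A
  -- point of `X` outside all sets with value at most some `g ∈ Λ` is maximal. Finitely many of
  -- these sets never cover `X`: the point of `X` belonging to the largest value among them escapes
  -- them all.
  · let Λ : Set R := {g | ∃ q ∈ X, ∀ B ∈ ℬ, q ∈ B → g < ν B}
    have := hsat X hX {B ∈ ℬ | ∃ g ∈ Λ, ν B ≤ g} (fun B hB => hB.1) (by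
      intro F hF hXF
      rcases F.eq_empty_or_nonempty with rfl | hFne
      · obtain ⟨q, hq⟩ := hXne
        simpa using hXF hq
      · obtain ⟨B₀, hB₀, hmax⟩ := F.exists_max_image ν hFne
        obtain ⟨-, g, ⟨q, hqX, hq⟩, hg⟩ := hF hB₀
        obtain ⟨B, hBF, hqB⟩ := hXF hqX
        exact absurd ((hmax B hBF).trans hg) (not_le.2 (hq B (hF hBF).1 hqB)))
    obtain ⟨p, hpX, hp⟩ := Set.not_subset.1 this
    refine ⟨p, hpX, fun q hq => hmono p q fun B hB hpB => ?_⟩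
    by_contra hcon
    push Not at hcon
    exact hp ⟨B, ⟨hB, ν B, ⟨q, hq, hcon⟩, le_rfl⟩, hpB⟩
  -- Some point of `B` avoids all members of `ℬ` of smaller value, so that its dimension is `ν B`.
  · have := hsat B (hsub hB) {B' ∈ ℬ | ν B' < ν B} (fun B' hB' => hB'.1)
      fun F hF => hcov B hB hBne F fun B' hB' => hF hB'
    obtain ⟨p, hpB, hp⟩ := Set.not_subset.1 this
    refine ⟨p, hpB, (hup p B hB hpB).antisymm
      (hlow p _ (Set.mem_insert_of_mem _ ⟨B, hB, rfl⟩) fun B' hB' hp' => ?_)⟩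
    by_contra hlt
    exact hp ⟨B', ⟨hB', not_le.1 hlt⟩, hp'⟩

end Diagonal

/-! ### Representatives and embeddings of ultraproducts. -/

section Ultraproduct

open FirstOrder.Language

variable {L : FirstOrder.Language.{u, v}}

theorem exists_rep_product {U : Ultrafilter ℕ} {A : ℕ → Type*} {β : Type*}
    (x : β → (U : Filter ℕ).Product A) :
    ∃ f : β → ∀ n, A n, x = fun i => (f i : (U : Filter ℕ).Product A) :=
  ⟨fun i => (Quotient.exists_rep (x i)).choose,
    funext fun i => (Quotient.exists_rep (x i)).choose_spec.symm⟩

theorem coe_product_eq_coe {U : Ultrafilter ℕ} {A : ℕ → Type*} {f g : ∀ n, A n} :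
    (f : (U : Filter ℕ).Product A) = (g : (U : Filter ℕ).Product A) ↔
      ∀ᶠ n in (U : Filter ℕ), f n = g n :=
  Quotient.eq''

theorem realize_iff_eventually {U : Ultrafilter ℕ} {A : ℕ → Type*} [∀ n, L.Structure (A n)]
    [∀ n, Nonempty (A n)] {β : Type*} (χ : L.Formula β) {x : β → (U : Filter ℕ).Product A}
    {f : β → ∀ n, A n} (hx : ∀ i, x i = (f i : (U : Filter ℕ).Product A)) :
    χ.Realize x ↔ ∀ᶠ n in (U : Filter ℕ), χ.Realize fun i => f i n := by
  obtain rfl : x = fun i => (f i : (U : Filter ℕ).Product A) := funext hx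
  exact Ultraproduct.realize_formula_cast χ f

theorem relMap_coe {U : Ultrafilter ℕ} {A : ℕ → Type*} [∀ n, L.Structure (A n)]
    [∀ n, Nonempty (A n)] {s : ℕ} (R : L.Relations s) (f : Fin s → ∀ n, A n) :
    Structure.RelMap R (fun i => (f i : (U : Filter ℕ).Product A)) ↔
      ∀ᶠ n in (U : Filter ℕ), Structure.RelMap R (fun i => f i n) := by
  have := Ultraproduct.realize_formula_cast (u := U) (R.formula (Term.var : Fin s → L.Term (Fin s))) f
  simpa only [Formula.realize_rel, Term.realize_var] using this

/-- Maps `h n : A n → B n` that preserve, for each relation symbol, the relation for almost all `n`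
induce an embedding of ultraproducts. -/
def ultraEmbedding [L.IsRelational] {U : Ultrafilter ℕ} {A B : ℕ → Type*} [∀ n, L.Structure (A n)]
    [∀ n, L.Structure (B n)] [∀ n, Nonempty (A n)] [∀ n, Nonempty (B n)] (h : ∀ n, A n → B n)
    (hinj : ∀ n, Function.Injective (h n))
    (hrel : ∀ (s : ℕ) (R : L.Relations s), ∀ᶠ n in (U : Filter ℕ), ∀ x : Fin s → A n,
      Structure.RelMap R (h n ∘ x) ↔ Structure.RelMap R x) :
    (U : Filter ℕ).Product A ↪[L] (U : Filter ℕ).Product B where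
  toFun := Quotient.map' (fun f n => h n (f n)) (fun f g hfg => by
    change ∀ᶠ n in (U : Filter ℕ), h n (f n) = h n (g n)
    filter_upwards [show ∀ᶠ n in (U : Filter ℕ), f n = g n from hfg] with n hn
    rw [hn])
  inj' := by
    intro x y
    induction x using Quotient.inductionOn with | _ f
    induction y using Quotient.inductionOn with | _ g
    intro hfg
    refine Quotient.sound ?_
    have : ∀ᶠ n in (U : Filter ℕ), h n (f n) = h n (g n) := Quotient.exact hfg
    exact this.mono fun n hn => hinj n hn
  map_fun' f := isEmptyElim f
  map_rel' := by
    intro s R x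
    obtain ⟨f, rfl⟩ := exists_rep_product x
    refine (relMap_coe R fun i n => h n (f i n)).trans (Iff.trans ?_ (relMap_coe R f).symm)
    refine eventually_congr ?_
    filter_upwards [hrel s R] with n hn
    exact hn fun i => f i n

theorem ultrapower_models {T : L.Theory} {U : Ultrafilter ℕ} {A : ℕ → Type*}
    [∀ n, L.Structure (A n)] [∀ n, Nonempty (A n)] [∀ n, A n ⊨ T] :
    (U : Filter ℕ).Product A ⊨ T :=
  ⟨fun χ hχ => (Ultraproduct.sentence_realize χ).2
    (Eventually.of_forall fun _ => Theory.realize_sentence_of_mem T hχ)⟩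

end Ultraproduct

/-! ### Internal sets and their fine dimension. -/

namespace FiniteApproximation

variable {L : FirstOrder.Language.{u, v}} {T : L.Theory} (S : FiniteApproximation T)
  {U : Ultrafilter ℕ} {k : ℕ}

section Internal

variable {S} {D D' : Set (Fin k → S.Ultra U)} {E E' : ∀ n, Set (Fin k → S.A n)}

/-- Points of `E n` outside `E' n`, chosen for almost all `n`, would form a point of `D` outside
`D'`. -/
theorem IsInternalWith.subset_iff (h : S.IsInternalWith U D E) (h' : S.IsInternalWith U D' E') :
    D ⊆ D' ↔ ∀ᶠ n in (U : Filter ℕ), E n ⊆ E' n := by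
  classical
  constructor
  · intro hsub
    by_contra hcon
    rw [← Ultrafilter.eventually_not] at hcon
    have hcon' : ∀ᶠ n in (U : Filter ℕ), ∃ x, x ∈ E n ∧ x ∉ E' n :=
      hcon.mono fun n hn => Set.not_subset.1 hn
    let f : Fin k → ∀ n, S.A n := fun i n =>
      if hn : ∃ x, x ∈ E n ∧ x ∉ E' n then hn.choose i else Classical.arbitrary _
    have hf : ∀ n, (hn : ∃ x, x ∈ E n ∧ x ∉ E' n) → (fun i => f i n) = hn.choose := by
      intro n hn
      ext i
      simp only [f, dif_pos hn]
    have h1 : (fun i => (f i : S.Ultra U)) ∈ D := (h f).2 (hcon'.mono fun n hn => by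
      rw [hf n hn]; exact hn.choose_spec.1)
    have h2 := (h' f).1 (hsub h1)
    obtain ⟨n, hn1, hn2⟩ := (h2.and hcon').exists
    rw [hf n hn2] at hn1
    exact hn2.choose_spec.2 hn1
  · intro hE x hx
    obtain ⟨f, rfl⟩ := exists_rep_product x
    exact (h' f).2 (((h f).1 hx).and hE |>.mono fun n hn => hn.2 hn.1)

theorem isInternalWith_empty : S.IsInternalWith U (∅ : Set (Fin k → S.Ultra U)) fun _ => ∅ :=
  fun _ => ⟨fun h => h.elim, fun h => h.exists.choose_spec.elim⟩

theorem IsInternalWith.nonempty_iff (h : S.IsInternalWith U D E) :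
    D.Nonempty ↔ ∀ᶠ n in (U : Filter ℕ), (E n).Nonempty := by
  have := h.subset_iff isInternalWith_empty
  simp only [Set.subset_empty_iff] at this
  rw [Set.nonempty_iff_ne_empty, ne_eq, this, ← Ultrafilter.eventually_not]
  simp only [Set.nonempty_iff_ne_empty, ne_eq]

theorem IsInternalWith.union (h : S.IsInternalWith U D E) (h' : S.IsInternalWith U D' E') :
    S.IsInternalWith U (D ∪ D') fun n => E n ∪ E' n :=
  fun f => (or_congr (h f) (h' f)).trans Ultrafilter.eventually_or.symm

/-- Two sequences that represent the same internal set agree almost everywhere, so the choice made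
in `card` is immaterial. -/
theorem IsInternalWith.card_eq (h : S.IsInternalWith U D E) :
    S.card U D = ((fun n => ((E n).ncard : ℝ) : ℕ → ℝ) : HyperReal U) := by
  have hex : ∃ E, S.IsInternalWith U D E := ⟨E, h⟩
  rw [card, dif_pos hex]
  refine Germ.coe_eq.2 ?_
  filter_upwards [(hex.choose_spec.subset_iff h).1 subset_rfl,
    (h.subset_iff hex.choose_spec).1 subset_rfl] with n h1 h2
  rw [h1.antisymm h2]

theorem IsInternalWith.fineDim_eq (h : S.IsInternalWith U D E) (hD : D.Nonempty) :
    S.fineDim U D = ((FineGroup.mk ((fun n => Real.log (E n).ncard : ℕ → ℝ) : HyperReal U) :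
      FineGroup U) : WithBot (FineGroup U)) := by
  rw [fineDim, if_neg hD.ne_empty, h.card_eq]
  rfl

theorem fineDim_empty : S.fineDim U (∅ : Set (Fin k → S.Ultra U)) = ⊥ := if_pos rfl

theorem one_le_ncard_of_nonempty {n : ℕ} {X : Set (Fin k → S.A n)} (h : X.Nonempty) :
    (1 : ℝ) ≤ X.ncard := by
  have := (Set.ncard_pos (Set.toFinite X)).2 h
  exact_mod_cast this

theorem IsInternalWith.fineDim_mono (h : S.IsInternalWith U D E) (h' : S.IsInternalWith U D' E')
    (hsub : D ⊆ D') : S.fineDim U D ≤ S.fineDim U D' := by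
  rcases D.eq_empty_or_nonempty with rfl | hD
  · rw [fineDim_empty]; exact bot_le
  rw [h.fineDim_eq hD, h'.fineDim_eq (hD.mono hsub), WithBot.coe_le_coe]
  refine FineGroup.mk_le_mk_of_le (Germ.coe_le.2 ?_)
  filter_upwards [(h.subset_iff h').1 hsub, h.nonempty_iff.1 hD] with n hn hne
  have h1 := one_le_ncard_of_nonempty hne
  exact Real.log_le_log (by linarith) (by exact_mod_cast Set.ncard_le_ncard hn (Set.toFinite _))

theorem IsInternalWith.fineDim_nonneg (h : S.IsInternalWith U D E) (hD : D.Nonempty) :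
    0 ≤ S.fineDim U D := by
  rw [h.fineDim_eq hD, ← WithBot.coe_zero, WithBot.coe_le_coe]
  refine FineGroup.mk_le_mk_of_le (x := 0) (Germ.coe_le.2 ?_)
  filter_upwards [h.nonempty_iff.1 hD] with n hne
  exact Real.log_nonneg (one_le_ncard_of_nonempty hne)

/-- The union has at most twice as many points as the larger set, and `log 2 ≤ 1` is absorbed by the
convex hull of `ℤ`. -/
theorem IsInternalWith.fineDim_union_le (h : S.IsInternalWith U D E)
    (h' : S.IsInternalWith U D' E') :
    S.fineDim U (D ∪ D') ≤ max (S.fineDim U D) (S.fineDim U D') := by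
  rcases D.eq_empty_or_nonempty with rfl | hD
  · simp
  rcases D'.eq_empty_or_nonempty with rfl | hD'
  · simp
  have hu := h.union h'
  rw [hu.fineDim_eq (hD.mono Set.subset_union_left), h.fineDim_eq hD, h'.fineDim_eq hD']
  have key : ∀ {x y : ℕ → ℝ}, (∀ᶠ n in (U : Filter ℕ), x n ≤ y n + 1) →
      ((FineGroup.mk (x : HyperReal U) : FineGroup U) : WithBot (FineGroup U)) ≤
        ((FineGroup.mk (y : HyperReal U) : FineGroup U) : WithBot (FineGroup U)) := by
    intro x y hxy
    refine WithBot.coe_le_coe.2 (FineGroup.mk_le_mk.2 ⟨1, ?_⟩)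
    rw [Nat.cast_one]
    exact Germ.coe_le.2 hxy
  have hlog : ∀ a b c : ℝ, 1 ≤ a → a ≤ b + c → 1 ≤ b → c ≤ b → Real.log a ≤ Real.log b + 1 := by
    intro a b c ha hab hb hcb
    have h2 : Real.log 2 ≤ 1 := by
      have := Real.log_two_lt_d9; linarith
    have : Real.log a ≤ Real.log (2 * b) := Real.log_le_log (by linarith) (by linarith)
    rw [Real.log_mul (by norm_num) (by linarith)] at this
    linarith
  have hle : ∀ n, ((E n ∪ E' n).ncard : ℝ) ≤ (E n).ncard + (E' n).ncard := fun n => by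
    exact_mod_cast Set.ncard_union_le _ _
  have hev : ∀ᶠ n in (U : Filter ℕ), (E' n).ncard ≤ (E n).ncard ∨ (E n).ncard ≤ (E' n).ncard :=
    Eventually.of_forall fun n => le_total _ _
  rcases Ultrafilter.eventually_or.1 hev with hev | hev
  · refine le_trans (key ?_) (le_max_left _ _)
    filter_upwards [hev, h.nonempty_iff.1 hD] with n hn hne
    exact hlog _ _ _ (one_le_ncard_of_nonempty (hne.mono Set.subset_union_left)) (hle n)
      (one_le_ncard_of_nonempty hne) (by exact_mod_cast hn)
  · refine le_trans (key ?_) (le_max_right _ _)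
    filter_upwards [hev, h'.nonempty_iff.1 hD'] with n hn hne
    exact hlog _ _ _ (one_le_ncard_of_nonempty (hne.mono Set.subset_union_right))
      ((hle n).trans (add_comm _ _).le) (one_le_ncard_of_nonempty hne) (by exact_mod_cast hn)

/-- If `|D'|` exceeds all finite multiples of `max 1 |D|`, then the dimension of `D'` is positive
and larger than that of `D`. -/
theorem IsInternalWith.max_fineDim_lt (h : S.IsInternalWith U D E)
    (h' : S.IsInternalWith U D' E') (hlt : ∀ C : ℕ, ∀ᶠ n in (U : Filter ℕ),
      C * max 1 (E n).ncard ≤ (E' n).ncard) :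
    max 0 (S.fineDim U D) < S.fineDim U D' := by
  have hD' : D'.Nonempty := h'.nonempty_iff.2 <| (hlt 1).mono fun n hn => by
    refine (Set.ncard_pos (Set.toFinite _)).1 ?_
    have := le_max_left 1 (E n).ncard
    omega
  have key : ∀ {x : ℕ → ℝ}, (∀ᶠ n in (U : Filter ℕ), x n ≤ Real.log (max 1 (E n).ncard : ℕ)) →
      ((FineGroup.mk (x : HyperReal U) : FineGroup U) : WithBot (FineGroup U)) <
        S.fineDim U D' := by
    -- Otherwise the logarithm of the ratio would be bounded by an integer `c`, which the hypothesis
    -- for a constant `C > exp c` excludes.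
    intro x hx
    rw [h'.fineDim_eq hD', WithBot.coe_lt_coe, ← not_le, FineGroup.mk_le_mk]
    rintro ⟨c, hc⟩
    have hc' : ∀ᶠ n in (U : Filter ℕ), Real.log (E' n).ncard ≤ x n + c := Germ.coe_le.1 hc
    obtain ⟨C, hC⟩ := exists_nat_gt (Real.exp c)
    obtain ⟨n, h1, h2, h3⟩ := (hc'.and (hx.and (hlt C))).exists
    have hpos : (0 : ℝ) < (max 1 (E n).ncard : ℕ) := by
      exact_mod_cast lt_of_lt_of_le Nat.one_pos (le_max_left _ _)
    have hCpos : (0 : ℝ) < C := (Real.exp_pos _).trans hC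
    have h4 : Real.log (C * (max 1 (E n).ncard : ℕ)) ≤ Real.log (E' n).ncard :=
      Real.log_le_log (by positivity) (by exact_mod_cast h3)
    rw [Real.log_mul hCpos.ne' hpos.ne'] at h4
    have h5 : (c : ℝ) < Real.log C := (Real.lt_log_iff_exp_lt hCpos).2 hC
    linarith
  refine max_lt ?_ ?_
  · have := key (x := fun _ => 0) (Eventually.of_forall fun n => Real.log_nonneg (by
      exact_mod_cast le_max_left _ _))
    exact this
  · rcases D.eq_empty_or_nonempty with rfl | hD
    · rw [fineDim_empty, h'.fineDim_eq hD']
      exact WithBot.bot_lt_coe _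
    · rw [h.fineDim_eq hD]
      refine key ?_
      filter_upwards [h.nonempty_iff.1 hD] with n hne
      refine Real.log_le_log (by have := one_le_ncard_of_nonempty hne; linarith) ?_
      exact_mod_cast le_max_right _ _

end Internal

end FiniteApproximation

/-! ### Definable sets, quasidimensions from points, dividing, and finite diagrams. -/

section ModelTheory

open FirstOrder.Language

variable {L : FirstOrder.Language.{u, v}}

/-- The formula in `(y, z)` saying that `φ(x, y)` implies `ψ(x, z)`. -/
noncomputable def inclusionFormula {k m l : ℕ} (φ : L.Formula (Fin k ⊕ Fin m))
    (ψ : L.Formula (Fin k ⊕ Fin l)) : L.Formula (Fin m ⊕ Fin l) :=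
  Formula.iAlls (Fin k) ((φ.relabel (Sum.elim Sum.inr (Sum.inl ∘ Sum.inl))).imp
    (ψ.relabel (Sum.elim Sum.inr (Sum.inl ∘ Sum.inr))))

theorem realize_inclusionFormula {Q : Type*} [L.Structure Q] {k m l : ℕ}
    (φ : L.Formula (Fin k ⊕ Fin m)) (ψ : L.Formula (Fin k ⊕ Fin l)) (c : Fin m → Q)
    (d : Fin l → Q) :
    (inclusionFormula φ ψ).Realize (Sum.elim c d) ↔ solutionSet φ c ⊆ solutionSet ψ d := by
  simp only [inclusionFormula, Formula.realize_iAlls]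
  refine forall_congr' fun x => ?_
  rw [Formula.realize_imp, Formula.realize_relabel, Formula.realize_relabel]
  simp only [Sum.comp_elim, ← Function.comp_assoc, Sum.elim_comp_inr]
  rfl

theorem solutionSet_subset_iff {N P : Type*} [L.Structure N] [L.Structure P] (j : N ↪ₑ[L] P)
    {k m l : ℕ} (φ : L.Formula (Fin k ⊕ Fin m)) (ψ : L.Formula (Fin k ⊕ Fin l)) (c : Fin m → N)
    (d : Fin l → N) :
    solutionSet φ (j ∘ c) ⊆ solutionSet ψ (j ∘ d) ↔ solutionSet φ c ⊆ solutionSet ψ d := by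
  rw [← realize_inclusionFormula, ← realize_inclusionFormula, ← Sum.comp_elim, j.map_formula]

theorem solutionSet_bot {Q : Type*} [L.Structure Q] {k m : ℕ} (d : Fin m → Q) :
    solutionSet (⊥ : L.Formula (Fin k ⊕ Fin m)) d = ∅ := by
  ext; simp [solutionSet]

theorem solutionSet_nonempty_iff {N P : Type*} [L.Structure N] [L.Structure P] (j : N ↪ₑ[L] P)
    {k m : ℕ} (φ : L.Formula (Fin k ⊕ Fin m)) (c : Fin m → N) :
    (solutionSet φ (j ∘ c)).Nonempty ↔ (solutionSet φ c).Nonempty := by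
  have := solutionSet_subset_iff j φ (⊥ : L.Formula (Fin k ⊕ Fin 0)) c Fin.elim0
  rw [solutionSet_bot, solutionSet_bot, Set.subset_empty_iff, Set.subset_empty_iff] at this
  rw [Set.nonempty_iff_ne_empty, Set.nonempty_iff_ne_empty, ne_eq, ne_eq, this]

theorem definable_solutionSet {P : Type*} [L.Structure P] {k m : ℕ} (φ : L.Formula (Fin k ⊕ Fin m))
    (c : Fin m → P) {A : Set P} (hc : ∀ i, c i ∈ A) : A.Definable L (solutionSet φ c) := by
  rw [Set.definable_iff_exists_formula_sum]
  refine ⟨φ.relabel (Sum.elim Sum.inr fun i => Sum.inl ⟨c i, hc i⟩), ?_⟩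
  ext x
  simp only [solutionSet, Set.mem_ofPred_eq, Formula.realize_relabel, Sum.comp_elim,
    Sum.elim_comp_inr]
  rfl

theorem definable_section {P : Type*} [L.Structure P] {k l : ℕ} {G : Set (Fin k ⊕ Fin l → P)}
    (hG : Set.univ.Definable L G) (z : Fin l → P) :
    Set.univ.Definable L {x : Fin k → P | Sum.elim x z ∈ G} := by
  rw [Set.definable_iff_exists_formula_sum] at hG ⊢
  obtain ⟨φ, rfl⟩ := hG
  refine ⟨φ.relabel (Sum.elim Sum.inl (Sum.elim Sum.inr fun i => Sum.inl ⟨z i, Set.mem_univ _⟩)),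
    ?_⟩
  ext x
  simp only [Set.mem_ofPred_eq, Formula.realize_relabel]
  refine iff_of_eq (congrArg _ ?_)
  ext i
  rcases i with i | i | i <;> rfl

theorem countable_definable [Countable L.Symbols] {P : Type*} [L.Structure P] {A : Set P}
    (hA : A.Countable) (β : Type*) [Countable β] : {B : Set (β → P) | A.Definable L B}.Countable := by
  have : Countable A := hA.to_subtype
  refine (Set.countable_range fun φ : L.Formula (A ⊕ β) =>
    {v : β → P | φ.Realize (Sum.elim (fun a : A => (a : P)) v)}).mono ?_
  intro B hB
  obtain ⟨φ, rfl⟩ := Set.definable_iff_exists_formula_sum.1 hB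
  exact ⟨φ, rfl⟩

/-- A dimension of points, of which the maximum over each nonempty definable set is attained,
gives a quasidimension. -/
theorem exists_isQuasidimension {M : Type w} [L.Structure M] {G : Type*}
    [AddCommGroup G] [LinearOrder G] [IsOrderedAddMonoid G]
    (d : ∀ k : ℕ, (Fin k → M) → WithBot G) (hd : ∀ k p, 0 ≤ d k p)
    (hmax : ∀ k (X : Set (Fin k → M)), Set.univ.Definable L X → X.Nonempty →
      ∃ p ∈ X, ∀ q ∈ X, d k q ≤ d k p) :
    ∃ δ : ∀ k : ℕ, Set (Fin k → M) → WithBot G, IsQuasidimension L M δ ∧ (∀ k, δ k ∅ = ⊥) ∧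
      ∀ k X g, IsGreatest (d k '' X) g → δ k X = g := by
  classical
  let δ : ∀ k : ℕ, Set (Fin k → M) → WithBot G := fun k X =>
    if h : ∃ g, IsGreatest (d k '' X) g then h.choose else ⊥
  have hδ : ∀ k X g, IsGreatest (d k '' X) g → δ k X = g := by
    intro k X g hg
    have hex : ∃ g, IsGreatest (d k '' X) g := ⟨g, hg⟩
    simp only [δ, dif_pos hex]
    exact hex.choose_spec.unique hg
  have hempty : ∀ k, δ k ∅ = ⊥ := by
    intro k
    have : ¬ ∃ g, IsGreatest (d k '' (∅ : Set (Fin k → M))) g := by simp [IsGreatest]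
    simp only [δ, dif_neg this]
  have hatt : ∀ k X, Set.univ.Definable L X → X.Nonempty → IsGreatest (d k '' X) (δ k X) := by
    intro k X hX hne
    obtain ⟨p, hp, hpm⟩ := hmax k X hX hne
    have : IsGreatest (d k '' X) (d k p) :=
      ⟨⟨p, hp, rfl⟩, by rintro _ ⟨q, hq, rfl⟩; exact hpm q hq⟩
    rwa [hδ k X _ this]
  have hnonneg : ∀ k X, Set.univ.Definable L X → X.Nonempty → 0 ≤ δ k X := by
    intro k X hX hne
    obtain ⟨p, hp, h⟩ := (hatt k X hX hne).1
    exact h ▸ hd k p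
  refine ⟨δ, ⟨hempty, fun k X hX hlt => ?_, fun k X Y hX hY => ?_, ?_⟩, hempty, hδ⟩
  · rcases X.eq_empty_or_nonempty with rfl | hne
    · rw [hempty] at hlt
      exact absurd hlt (lt_irrefl _)
    · exact hnonneg k X hX hne
  · rcases X.eq_empty_or_nonempty with rfl | hXne
    · simp [hempty]
    rcases Y.eq_empty_or_nonempty with rfl | hYne
    · simp [hempty]
    refine hδ k _ _ ?_
    rw [Set.image_union]
    exact (hatt k X hX hXne).union (hatt k Y hY hYne)
  · intro k l X Z f hX hZ hf hG α hα
    rcases X.eq_empty_or_nonempty with rfl | hXne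
    · rw [hempty]; exact bot_le
    obtain ⟨p, hp, hpδ⟩ := (hatt k X hX hXne).1
    have hfib : {x ∈ X | f x = f p} =
        {x : Fin k → M | Sum.elim x (f p) ∈ {p : Fin k ⊕ Fin l → M |
          p ∘ Sum.inl ∈ X ∧ f (p ∘ Sum.inl) = p ∘ Sum.inr}} := by
      ext x
      simp
    -- `p` has maximal dimension in `X` and lies in the fibre over `f p`, so this fibre has
    -- dimension at least that of `X`.
    have h1 : δ k X ≤ α := by
      refine le_trans ?_ (hα (f p) (hf hp))
      rw [← hpδ]
      have hdef : Set.univ.Definable L {x ∈ X | f x = f p} := by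
        rw [hfib]; exact definable_section hG (f p)
      exact (hatt k _ hdef ⟨p, hp, rfl⟩).2 ⟨p, ⟨hp, rfl⟩, rfl⟩
    calc δ k X ≤ α := h1
      _ = α + 0 := (add_zero α).symm
      _ ≤ α + δ l Z := by gcongr; exact hnonneg l Z hZ ⟨f p, hf hp⟩

/-- The formula saying that no `r` of the formulas `φ(x, y i)` have a common solution. -/
theorem exists_inconsistency_formula {k l : ℕ} (φ : L.Formula (Fin k ⊕ Fin l)) (K r : ℕ) :
    ∃ χ : L.Formula (Fin K × Fin l), ∀ (Q : Type w) [L.Structure Q] (t : Fin K → Fin l → Q),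
      χ.Realize (fun p => t p.1 p.2) ↔
        ∀ I : Finset (Fin K), I.card = r → ¬ ∃ x : Fin k → Q, ∀ i ∈ I, x ∈ solutionSet φ (t i) := by
  refine ⟨Formula.iInf fun I : {I : Finset (Fin K) // I.card = r} =>
    (Formula.iExs (Fin k) (Formula.iInf fun i : I.1 =>
      (φ.relabel (Sum.elim Sum.inr fun s => Sum.inl (i.1, s)) :
        L.Formula ((Fin K × Fin l) ⊕ Fin k)))).not, fun Q _ t => ?_⟩
  simp only [Formula.realize_iInf, Formula.realize_not, Formula.realize_iExs, Subtype.forall,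
    Formula.realize_relabel, Sum.comp_elim, Sum.elim_comp_inr]
  rfl

/-- Dividing is witnessed in an elementary extension, but the existence of `K` tuples satisfying a
single formula `χ` with `r`-inconsistent instances is a first-order property `τ` of `a`, and so
holds in `N`. -/
theorem exists_inconsistent_tuples {N : Type w} [L.Structure N] {k m l : ℕ}
    {φ : L.Formula (Fin k ⊕ Fin l)} {b : Fin l → N} {a : Fin m → N} (h : Divides φ b a) :
    ∃ r, 1 ≤ r ∧ ∀ (K : ℕ) (χ : L.Formula (Fin m ⊕ Fin l)), χ.Realize (Sum.elim a b) →
      ∃ t : Fin K → Fin l → N, (∀ i, χ.Realize (Sum.elim a (t i))) ∧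
        ∀ I : Finset (Fin K), I.card = r → ¬ ∃ x : Fin k → N, ∀ i ∈ I, x ∈ solutionSet φ (t i) := by
  obtain ⟨P, _, j, s, r, hr, htype, hinc⟩ := h
  refine ⟨r, hr, fun K χ hχ => ?_⟩
  obtain ⟨η, hη⟩ := exists_inconsistency_formula φ K r
  let τ : L.Formula (Fin m) := Formula.iExs (Fin K × Fin l)
    ((Formula.iInf fun i : Fin K => (χ.relabel (Sum.map id fun s => (i, s)) :
      L.Formula (Fin m ⊕ (Fin K × Fin l)))) ⊓ η.relabel Sum.inr)
  have hτ : ∀ (Q : Type w) [L.Structure Q] (a : Fin m → Q), τ.Realize a ↔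
      ∃ t : Fin K → Fin l → Q, (∀ i, χ.Realize (Sum.elim a (t i))) ∧
        ∀ I : Finset (Fin K), I.card = r →
          ¬ ∃ x : Fin k → Q, ∀ i ∈ I, x ∈ solutionSet φ (t i) := by
    intro Q _ a
    simp only [τ, Formula.realize_iExs, Formula.realize_inf, Formula.realize_iInf,
      Formula.realize_relabel, Sum.elim_comp_map, Sum.elim_comp_inr, Function.comp_id]
    constructor
    · rintro ⟨t, h1, h2⟩
      exact ⟨fun i s => t (i, s), h1, (hη Q fun i s => t (i, s)).1 h2⟩
    · rintro ⟨t, h1, h2⟩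
      exact ⟨fun p => t p.1 p.2, h1, (hη Q t).2 h2⟩
  refine (hτ N a).1 ((j.map_formula τ a).1 ((hτ P _).2 ⟨fun i => s i, fun i => ?_, ?_⟩))
  · rw [htype i χ, ← Sum.comp_elim, j.map_formula]
    exact hχ
  · rintro I hI ⟨x, hx⟩
    refine hinc (I.map Fin.valEmbedding) (by rw [Finset.card_map, hI]) ⟨x, fun i hi => ?_⟩
    obtain ⟨i', hi', rfl⟩ := Finset.mem_map.1 hi
    exact hx i' hi'

/-- If at most `r` of the `C * r` sets `D i ⊆ X` have a common point, then one of them is small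
compared to `X`. -/
theorem exists_mul_ncard_le {E : Type*} [Finite E] {C r : ℕ} (hC : 0 < C) (hr : 0 < r)
    (X : Set E) (D : Fin (C * r) → Set E) (hD : ∀ i, D i ⊆ X)
    (h : ∀ I : Finset (Fin (C * r)), I.card = r → ¬ ∃ x, ∀ i ∈ I, x ∈ D i) :
    ∃ i, C * (D i).ncard ≤ X.ncard := by
  classical
  have := Fintype.ofFinite E
  by_contra hcon
  push Not at hcon
  have hcard : ∀ x, (Finset.univ.filter fun i => x ∈ D i).card ≤ r := by
    intro x
    by_contra hlt
    obtain ⟨I, hI, hIr⟩ := Finset.exists_subset_card_eq (not_le.1 hlt).le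
    exact h I hIr ⟨x, fun i hi => (Finset.mem_filter.1 (hI hi)).2⟩
  -- Double counting: each point of `X` lies in at most `r` of the sets. If the claim failed, `C`
  -- times this sum would exceed `C * r * X.ncard`.
  have hsum : ∑ i, (D i).ncard ≤ X.ncard * r := by
    calc ∑ i, (D i).ncard = ∑ i, ∑ x ∈ X.toFinset, if x ∈ D i then 1 else 0 := by
          refine Finset.sum_congr rfl fun i _ => ?_
          rw [← Finset.card_filter, Set.ncard_eq_toFinset_card']
          congr 1
          ext x
          simpa using fun hx => hD i hx
      _ = ∑ x ∈ X.toFinset, (Finset.univ.filter fun i => x ∈ D i).card := by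
          rw [Finset.sum_comm]
          simp only [Finset.card_filter]
      _ ≤ ∑ _x ∈ X.toFinset, r := Finset.sum_le_sum fun x _ => hcard x
      _ = X.ncard * r := by rw [Finset.sum_const, smul_eq_mul, Set.ncard_eq_toFinset_card']
  have hlt : ∑ i : Fin (C * r), X.ncard < ∑ i, C * (D i).ncard :=
    Finset.sum_lt_sum_of_nonempty ⟨⟨0, Nat.mul_pos hC hr⟩, Finset.mem_univ _⟩ fun i _ => hcon i
  rw [← Finset.mul_sum, Finset.sum_const, Finset.card_univ, Fintype.card_fin, smul_eq_mul] at hlt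
  have := Nat.mul_le_mul_left C hsum
  have e : C * (X.ncard * r) = C * r * X.ncard := by ring
  omega

open Classical in
/-- The formula in variables `A` saying that the variables are distinct and satisfy the same
relations of `F` as in `A`. -/
noncomputable def diagramFormula (A : Type*) [L.Structure A] [Finite A]
    (F : Set (Σ s, L.Relations s)) [Finite F] : L.Formula A :=
  Formula.iInf (fun p : A × A => if p.1 = p.2 then ⊤ else
      ((Term.var p.1).equal (Term.var p.2) : L.Formula A).not) ⊓
    Formula.iInf fun p : (Σ R : F, Fin R.1.1 → A) =>
      if Structure.RelMap p.1.1.2 p.2 then p.1.1.2.formula (fun i => Term.var (p.2 i))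
      else (p.1.1.2.formula (fun i => Term.var (p.2 i)) : L.Formula A).not

theorem realize_diagramFormula {A : Type*} [L.Structure A] [Finite A]
    {F : Set (Σ s, L.Relations s)} [Finite F] {Q : Type*} [L.Structure Q] (h : A → Q) :
    (diagramFormula A F).Realize h ↔ Function.Injective h ∧
      ∀ R ∈ F, ∀ x : Fin R.1 → A, Structure.RelMap R.2 (h ∘ x) ↔ Structure.RelMap R.2 x := by
  simp only [diagramFormula, Formula.realize_inf, Formula.realize_iInf, Prod.forall, Sigma.forall,
    Subtype.forall]
  refine and_congr (forall₂_congr fun x y => ?_) (forall₂_congr fun s R => forall₂_congr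
    fun hR x => ?_)
  · split_ifs with hxy
    · simp [hxy]
    · rw [Formula.realize_not, Formula.realize_equal]
      simp [hxy]
  · split_ifs with hx
    · rw [Formula.realize_rel]
      simp only [Term.realize_var, hx, iff_true]
      rfl
    · rw [Formula.realize_not, Formula.realize_rel]
      simp only [Term.realize_var, hx, iff_false]
      rfl

/-- Finite substructures of models of a complete theory embed into every model, as far as finitely
many relations are concerned. -/
theorem exists_injective_preserving [L.IsRelational] {T : L.Theory} (hT : T.IsComplete)
    (N : Type*) [L.Structure N] [N ⊨ T] [Nonempty N] {P : Type*} [L.Structure P] [P ⊨ T]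
    [Nonempty P] {A : Type*} [L.Structure A] [Finite A] (ι : A ↪[L] P)
    (F : Set (Σ s, L.Relations s)) (hF : F.Finite) :
    ∃ h : A → N, Function.Injective h ∧ ∀ R ∈ F, ∀ x : Fin R.1 → A,
      Structure.RelMap R.2 (h ∘ x) ↔ Structure.RelMap R.2 x := by
  have : Finite F := hF
  -- Finiteness of `A` and `F` makes this a single sentence, which completeness transfers from `P`
  -- to `N`.
  let σ : L.Sentence := Formula.iExs A ((diagramFormula A F).relabel (Sum.inr : A → Empty ⊕ A))
  have hP : P ⊨ σ := by
    change Formula.Realize _ _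
    rw [Formula.realize_iExs]
    refine ⟨ι, ?_⟩
    rw [Formula.realize_relabel, Sum.elim_comp_inr, realize_diagramFormula]
    exact ⟨ι.injective, fun R _ x => ι.map_rel R.2 x⟩
  have hN : N ⊨ σ := (hT.realize_sentence_iff σ N).2 ((hT.realize_sentence_iff σ P).1 hP)
  change Formula.Realize _ _ at hN
  rw [Formula.realize_iExs] at hN
  obtain ⟨h, hh⟩ := hN
  rw [Formula.realize_relabel, Sum.elim_comp_inr, realize_diagramFormula] at hh
  exact ⟨h, hh⟩

end ModelTheory

open FirstOrder.Language

/-! ### Traces on `V_ω`, and the embedding into an ultrapower of `N`. -/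

section Trace

variable {L : FirstOrder.Language.{u, v}} {T : L.Theory}

namespace FiniteApproximation

variable (S : FiniteApproximation T) {U : Ultrafilter ℕ}

theorem coe_mem_ultraV {α : Level} {f : ∀ n, S.A n} :
    (f : S.Ultra U) ∈ S.ultraV U α ↔ ∀ᶠ n in (U : Filter ℕ), f n ∈ S.V n α := by
  constructor
  · rintro ⟨g, hg, hgV⟩
    filter_upwards [coe_product_eq_coe.1 hg, hgV] with n h1 h2
    rwa [← h1]
  · exact fun h => ⟨f, rfl, h⟩

theorem ultraV_mono : Monotone (S.ultraV U) := by
  rintro α β hαβ _ ⟨f, rfl, hf⟩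
  exact ⟨f, rfl, hf.mono fun n hn => S.V_mono n hαβ hn⟩

/-- Each task occurs at some index `i` of the enumeration, and `A n` strongly satisfies it for all
`n > i`. -/
theorem eventually_stronglySatisfies (hU : (U : Filter ℕ) ≤ cofinite) {β : Type*} [Finite β]
    {q : ℕ} (θ : L.Formula (β ⊕ Fin q)) (hθ : θ.IsQF) (α : Level) :
    ∀ᶠ n in (U : Filter ℕ), ∀ c : β → S.A n, (∀ i, c i ∈ S.V n α) →
      (∃ (P : Theory.ModelType.{u, v, max u v} T) (ι : S.A n ↪[L] P) (d : Fin q → P),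
        θ.Realize (Sum.elim (ι ∘ c) d)) →
      ∃ d : Fin q → S.A n, (∀ i, d i ∈ S.V n α.next) ∧ θ.Realize (Sum.elim c d) := by
  obtain ⟨p, ⟨e⟩⟩ := Finite.exists_equiv_fin β
  obtain ⟨i, hi⟩ := (S.task_infinite
    ⟨p, q, θ.relabel (Sum.map e id), hθ.relabel _, α⟩).nonempty
  have hgt : ∀ᶠ n in (U : Filter ℕ), i < n := by
    rw [Nat.cofinite_eq_atTop] at hU
    exact hU (eventually_gt_atTop i)
  filter_upwards [hgt] with n hn c hc hP
  have := S.strong n i hn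
  rw [show S.task i = _ from hi] at this
  obtain ⟨P, ι, d, hd⟩ := hP
  obtain ⟨d', hd'V, hd'⟩ := this (c ∘ e.symm) (fun i => hc _) ⟨P, ι, d, by
    rw [Formula.realize_relabel, ← Function.comp_assoc, Sum.elim_comp_map, Function.comp_assoc,
      e.symm_comp_self]
    exact hd⟩
  refine ⟨d', hd'V, ?_⟩
  rw [Formula.realize_relabel, Sum.elim_comp_map, Function.comp_assoc, e.symm_comp_self] at hd'
  exact hd'

/-- The set of tuples from `V_ω` that are mapped into `B`. -/
def trace {M : Type*} (H : S.Ultra U → M) {k : ℕ} (B : Set (Fin k → M)) :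
    Set (Fin k → S.Ultra U) :=
  {x | (∀ i, x i ∈ S.ultraV U (Level.inf 0)) ∧ H ∘ x ∈ B}

variable {S}

theorem trace_mono {M : Type*} {H : S.Ultra U → M} {k : ℕ} {B B' : Set (Fin k → M)}
    (h : B ⊆ B') : S.trace H B ⊆ S.trace H B' := fun _ hx => ⟨hx.1, h hx.2⟩

theorem trace_union {M : Type*} {H : S.Ultra U → M} {k : ℕ} {B B' : Set (Fin k → M)} :
    S.trace H (B ∪ B') = S.trace H B ∪ S.trace H B' := by
  ext x
  exact and_or_left

theorem isInternalWith_trace [L.IsRelational] {N : Type w} [L.Structure N] [Nonempty N]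
    (h : ∀ n, S.A n → N) (hinj : ∀ n, Function.Injective (h n))
    (hrel : ∀ (s : ℕ) (R : L.Relations s), ∀ᶠ n in (U : Filter ℕ), ∀ x : Fin s → S.A n,
      Structure.RelMap R (h n ∘ x) ↔ Structure.RelMap R x) {k : ℕ} {β : Type*}
    (χ : L.Formula (Fin k ⊕ β)) (g : β → ℕ → N) :
    S.IsInternalWith U (S.trace (ultraEmbedding h hinj hrel)
        {y | χ.Realize (Sum.elim y fun b => (g b : (U : Filter ℕ).Product fun _ => N))})
      fun n => {x | (∀ i, x i ∈ S.V n (Level.inf 0)) ∧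
        χ.Realize (Sum.elim (h n ∘ x) fun b => g b n)} := by
  intro f
  refine (and_congr (Iff.trans (forall_congr' fun i => S.coe_mem_ultraV) eventually_all.symm)
    ?_).trans eventually_and.symm
  have := realize_iff_eventually (U := U) χ
    (x := Sum.elim (fun i => ((fun n => h n (f i n) : ℕ → N) : (U : Filter ℕ).Product fun _ => N))
      fun b => (g b : (U : Filter ℕ).Product fun _ => N))
    (f := Sum.elim (fun i n => h n (f i n)) g) (by rintro (i | i) <;> rfl)
  refine this.trans (eventually_congr (Eventually.of_forall fun n => iff_of_eq (congrArg _ ?_)))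
  ext i
  rcases i with i | i <;> rfl

/-- In `V_ω`, the solutions of an existential formula in the ultraproduct are the solutions in any
model of `T` into which the ultraproduct embeds. -/
theorem omegaSolutionSet_eq_trace [L.IsRelational] (hmc : IsModelComplete T)
    (hU : (U : Filter ℕ) ≤ cofinite) {M : Type*} [L.Structure M] [M ⊨ T] [Nonempty M]
    (H : S.Ultra U ↪[L] M) {k m : ℕ} (φ : L.Formula (Fin k ⊕ Fin m)) (hφ : φ.IsExistential)
    (c : Fin m → S.Ultra U) (hc : ∀ i, c i ∈ S.ultraV U (Level.inf 0)) :
    S.omegaSolutionSet U φ c = S.trace H (solutionSet φ (H ∘ c)) := by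
  ext x
  refine and_congr_right fun hx => ?_
  constructor
  · intro h
    have := hφ.realize_embedding H h
    rw [Subsingleton.elim (H ∘ (default : Fin 0 → S.Ultra U)) default, Sum.comp_elim] at this
    exact this
  · intro h
    obtain ⟨q, θ, hθ, hφθ⟩ := exists_isQF_of_isExistential hφ
    obtain ⟨q', θ', hθ', hφθ'⟩ := exists_isQF_of_isModelComplete hmc φ.not
    obtain ⟨y, hy⟩ := exists_rep_product (Sum.elim x c)
    have hyV : ∀ᶠ n in (U : Filter ℕ), ∀ i, y i n ∈ S.V n (Level.inf 0) := by
      refine eventually_all.2 fun i => S.coe_mem_ultraV.1 ?_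
      rw [← congrFun hy i]
      rcases i with i | i
      exacts [hx i, hc i]
    -- A model of `T` extending `A n` decides `φ` at the tuple. Both `φ` and `¬φ` are existential
    -- modulo `T`, so strong satisfaction at level `ω` gives a witness for one of them in `A n`.
    have hor : ∀ᶠ n in (U : Filter ℕ), (θ.iExs (Fin q)).Realize (fun i => y i n) ∨
        (θ'.iExs (Fin q')).Realize (fun i => y i n) := by
      filter_upwards [hyV, S.eventually_stronglySatisfies hU θ hθ (Level.inf 0),
        S.eventually_stronglySatisfies hU θ' hθ' (Level.inf 0)] with n hn h1 h2
      simp only [Formula.realize_iExs]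
      obtain ⟨P, ⟨ι⟩⟩ := S.extends_to_model n
      by_cases hP : φ.Realize (ι ∘ fun i => y i n)
      · obtain ⟨d, -, hd⟩ := h1 _ hn ⟨P, ι, (realize_iff_exists_of_models hφθ P _).1 hP⟩
        exact .inl ⟨d, hd⟩
      · obtain ⟨d, -, hd⟩ := h2 _ hn ⟨P, ι, (realize_iff_exists_of_models hφθ' P _).1
          (Formula.realize_not.2 hP)⟩
        exact .inr ⟨d, hd⟩
    rcases Ultrafilter.eventually_or.1 hor with h1 | h1
    · have := (realize_iff_eventually (θ.iExs (Fin q)) (congrFun hy)).2 h1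
      rw [Formula.realize_iExs] at this
      exact (realize_iff_exists_of_models hφθ (S.Ultra U) _).2 this
    -- A witness for `¬φ` in the ultraproduct would survive in `M`, contrary to `h`.
    · have := (realize_iff_eventually (θ'.iExs (Fin q')) (congrFun hy)).2 h1
      rw [Formula.realize_iExs] at this
      obtain ⟨z, hz⟩ := this
      have hz' := (realize_iff_of_isQF hθ' H _).2 hz
      rw [Sum.comp_elim] at hz'
      have hn := (realize_iff_exists_of_models hφθ' M _).2 ⟨_, hz'⟩
      rw [Formula.realize_not, Sum.comp_elim] at hn
      exact absurd h hn

/-- Finitely many relations can be preserved for each `n`; as there are countably many, a diagonal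
choice preserves each of them for almost all `n`. -/
theorem exists_relation_preserving [L.IsRelational] [Countable L.Symbols] (hT : T.IsComplete)
    (hU : (U : Filter ℕ) ≤ cofinite) (N : Type w) [L.Structure N] [N ⊨ T] [Nonempty N] :
    ∃ h : ∀ n, S.A n → N, (∀ n, Function.Injective (h n)) ∧
      ∀ (s : ℕ) (R : L.Relations s), ∀ᶠ n in (U : Filter ℕ), ∀ x : Fin s → S.A n,
        Structure.RelMap R (h n ∘ x) ↔ Structure.RelMap R x := by
  have : Countable (Σ s, L.Relations s) :=
    (Sum.inr_injective (α := Σ s, L.Functions s)).countable (β := L.Symbols)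
  obtain ⟨e, he⟩ := exists_injective_nat (Σ s, L.Relations s)
  obtain ⟨h, hh⟩ := exists_diagonal hU
    (β := fun n => {h : S.A n → N // Function.Injective h})
    (fun i n h => ∀ R : Σ s, L.Relations s, e R = i → ∀ x : Fin R.1 → S.A n,
        Structure.RelMap R.2 (h.1 ∘ x) ↔ Structure.RelMap R.2 x) (fun C => by
      have : ∀ n, ∃ h : S.A n → N, Function.Injective h ∧ ∀ R ∈ {R | e R ≤ C},
          ∀ x : Fin R.1 → S.A n, Structure.RelMap R.2 (h ∘ x) ↔ Structure.RelMap R.2 x := by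
        intro n
        obtain ⟨P, ⟨ι⟩⟩ := S.extends_to_model n
        exact exists_injective_preserving hT N ι _ ((Set.finite_Iic C).preimage he.injOn)
      choose h hinj hh using this
      exact ⟨fun n => ⟨h n, hinj n⟩, Eventually.of_forall fun n i hi R hR =>
        hh n R (by simpa [hR] using hi)⟩)
  exact ⟨fun n => (h n).1, fun n => (h n).2, fun s R =>
    (hh (e ⟨s, R⟩)).mono fun n hn => hn ⟨s, R⟩ rfl⟩

end FiniteApproximation

end Trace

/-! ### Countable saturation of the ultrapower for definable sets. -/

section Saturation

variable {L : FirstOrder.Language.{u, v}} {U : Ultrafilter ℕ} {N : Type w} [L.Structure N]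
  [Nonempty N] {k : ℕ}

theorem exists_internal_of_definable {B : Set (Fin k → (U : Filter ℕ).Product fun _ => N)}
    (hB : Set.univ.Definable L B) :
    ∃ E : ℕ → Set (Fin k → N), ∀ f : Fin k → ℕ → N,
      (fun i => (f i : (U : Filter ℕ).Product fun _ => N)) ∈ B ↔
        ∀ᶠ n in (U : Filter ℕ), (fun i => f i n) ∈ E n := by
  obtain ⟨φ, rfl⟩ := Set.definable_iff_exists_formula_sum.1 hB
  obtain ⟨g, hg⟩ := exists_rep_product
    (fun a : (Set.univ : Set ((U : Filter ℕ).Product fun _ => N)) => a.1)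
  refine ⟨fun n => {x | φ.Realize (Sum.elim (fun a => g a n) x)}, fun f => ?_⟩
  have := realize_iff_eventually (U := U) φ
    (x := Sum.elim (fun a => a.1) fun i => (f i : (U : Filter ℕ).Product fun _ => N))
    (f := Sum.elim g f) (by rintro (i | i); exacts [congrFun hg i, rfl])
  refine this.trans (eventually_congr (Eventually.of_forall fun n => iff_of_eq (congrArg _ ?_)))
  ext i
  rcases i with i | i <;> rfl

/-- Countable saturation of the ultrapower: countably many definable sets that cover a definable
set contain a finite cover. -/
theorem not_subset_sUnion_of_countable (hU : (U : Filter ℕ) ≤ cofinite)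
    {X : Set (Fin k → (U : Filter ℕ).Product fun _ => N)} (hX : Set.univ.Definable L X)
    {𝓕 : Set (Set (Fin k → (U : Filter ℕ).Product fun _ => N))} (h𝓕 : 𝓕.Countable)
    (hdef : ∀ B ∈ 𝓕, Set.univ.Definable L B)
    (h : ∀ F : Finset (Set (Fin k → (U : Filter ℕ).Product fun _ => N)),
      (F : Set (Set (Fin k → (U : Filter ℕ).Product fun _ => N))) ⊆ 𝓕 → ¬ X ⊆ ⋃₀ F) :
    ¬ X ⊆ ⋃₀ 𝓕 := by
  classical
  rcases 𝓕.eq_empty_or_nonempty with rfl | hne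
  · exact_mod_cast h ∅ (by simp)
  obtain ⟨B, rfl⟩ := h𝓕.exists_eq_range hne
  obtain ⟨E₀, hE₀⟩ := exists_internal_of_definable hX
  choose E hE using fun i => exists_internal_of_definable (hdef (B i) (Set.mem_range_self i))
  obtain ⟨b, hb⟩ := exists_diagonal hU (β := fun _ => Fin k → N)
    (fun i n x => x ∈ E₀ n ∧ x ∉ E i n) (fun C => by
      obtain ⟨p, hpX, hp⟩ := Set.not_subset.1 (h ((Finset.range (C + 1)).image B) (by
        intro B' hB'
        simp only [Finset.coe_image, Set.mem_image] at hB'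
        obtain ⟨i, -, rfl⟩ := hB'
        exact Set.mem_range_self i))
      obtain ⟨f, rfl⟩ := exists_rep_product p
      refine ⟨fun n i => f i n, ?_⟩
      have h1 := (hE₀ f).1 hpX
      have h2 : ∀ᶠ n in (U : Filter ℕ), ∀ i ∈ Finset.range (C + 1), (fun s => f s n) ∉ E i n := by
        rw [Filter.eventually_all_finset]
        intro i hi
        rw [Ultrafilter.eventually_not, ← hE i f]
        intro hmem
        exact hp ⟨B i, by simpa using ⟨i, by simpa using hi, rfl⟩, hmem⟩
      filter_upwards [h1, h2] with n hn1 hn2 i hi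
      exact ⟨hn1, hn2 i (by simp; omega)⟩)
  intro hsub
  have hmem : (fun i => ((fun n => b n i : ℕ → N) : (U : Filter ℕ).Product fun _ => N)) ∈ X :=
    (hE₀ fun i n => b n i).2 ((hb 0).mono fun n hn => hn.1)
  obtain ⟨_, ⟨i, rfl⟩, hi⟩ := hsub hmem
  have h1 := (hE i fun i n => b n i).1 hi
  obtain ⟨n, hn1, hn2⟩ := (h1.and (hb i)).exists
  exact hn2.2 hn1

end Saturation

open FirstOrder.Language

variable {L : FirstOrder.Language.{u, v}} {T : L.Theory}

/-! ### Computing `δ_N` in the ultrapower, and dividing lowers dimension. -/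

namespace PseudofiniteEmbedding

variable [L.IsRelational] {N : Type w} [L.Structure N] (F : PseudofiniteEmbedding T N)

theorem embed_mem_ultraV (x : N) :
    (F.embed x : F.approx.Ultra F.U) ∈ F.approx.ultraV F.U (Level.inf 0) := by
  obtain ⟨n, hn⟩ := (F.embed x).2
  exact F.approx.ultraV_mono (Sum.Lex.inl_le_inr n 0) hn

/-- Solutions in `N` are sent by `embed` into `V_{<ω}`, which is contained in `V_ω`. -/
theorem trace_solutionSet_nonempty {M : Type*} [L.Structure M] (H : F.approx.Ultra F.U ↪[L] M)
    (j : N ↪ₑ[L] M) (hj : ∀ x, j x = H (F.embed x)) {k m : ℕ} (θ : L.Formula (Fin k ⊕ Fin m))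
    (c : Fin m → N) (h : (solutionSet θ c).Nonempty) :
    (F.approx.trace H (solutionSet θ (j ∘ c))).Nonempty := by
  obtain ⟨x, hx⟩ := h
  refine ⟨fun i => F.embed (x i), fun i => F.embed_mem_ultraV (x i), ?_⟩
  have e : (H ∘ fun i => (F.embed (x i) : F.approx.Ultra F.U)) = j ∘ x :=
    funext fun i => (hj (x i)).symm
  rw [e]
  change θ.Realize (Sum.elim (j ∘ x) (j ∘ c))
  rw [← Sum.comp_elim, j.map_formula]
  exact hx

/-- The dimension `δ_N` of a definable set, computed in a model of `T` containing the
ultraproduct. -/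
theorem dim_solutionSet (hmc : IsModelComplete T) [N ⊨ T] [Nonempty N] {M : Type*} [L.Structure M]
    [M ⊨ T] [Nonempty M] (H : F.approx.Ultra F.U ↪[L] M)
    (j : N ↪ₑ[L] M) (hj : ∀ x, j x = H (F.embed x)) {k m : ℕ} (θ : L.Formula (Fin k ⊕ Fin m))
    (c : Fin m → N) :
    F.dim k (solutionSet θ c) =
      F.approx.fineDim F.U (F.approx.trace H (solutionSet θ (j ∘ c))) := by
  have hex : Nonempty (ExistentialDefinition (L := L) (solutionSet θ c)) := by
    obtain ⟨θ', hθ', h⟩ := exists_isExistential_of_isModelComplete.{u, v, w} hmc θ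
    exact ⟨⟨m, θ', hθ', c, Set.ext fun x => (h N _).symm⟩⟩
  rw [dim, dif_pos hex, FiniteApproximation.omegaSolutionSet_eq_trace hmc F.nonprincipal H _
    hex.some.isExistential _ fun i => F.embed_mem_ultraV _]
  have e : (H ∘ fun i => (F.embed (hex.some.c i) : F.approx.Ultra F.U)) = j ∘ hex.some.c :=
    funext fun i => (hj _).symm
  rw [e]
  have heq := hex.some.eq
  -- The formula chosen in `dim` and `θ` define the same set in `N`, hence in `M` because `j` is
  -- elementary; this is why the choice does not matter.
  congr 2
  exact ((solutionSet_subset_iff j _ _ _ _).2 heq.ge).antisymm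
    ((solutionSet_subset_iff j _ _ _ _).2 heq.le)

/-- If `φ(x, b)` divides over `a` and implies `ψ(x, a)`, then there is a conjugate of `φ(x, b)`
over `a`, in the ultrapower of `N`, of smaller dimension than `ψ(x, a)`. -/
theorem exists_conjugate_fineDim_lt [Nonempty N] [Countable L.Symbols] (h : ∀ n, F.approx.A n → N)
    (hinj : ∀ n, Function.Injective (h n))
    (hrel : ∀ (s : ℕ) (R : L.Relations s), ∀ᶠ n in (F.U : Filter ℕ), ∀ x : Fin s → F.approx.A n,
      Structure.RelMap R (h n ∘ x) ↔ Structure.RelMap R x)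
    (j : N ↪ₑ[L] (F.U : Filter ℕ).Product fun _ => N)
    (hj : ∀ x, j x = ultraEmbedding h hinj hrel (F.embed x : F.approx.Ultra F.U)) {k m l : ℕ}
    (ψ : L.Formula (Fin k ⊕ Fin m)) (φ : L.Formula (Fin k ⊕ Fin l)) (a : Fin m → N)
    (b : Fin l → N) (himp : solutionSet φ b ⊆ solutionSet ψ a) (hne : (solutionSet φ b).Nonempty)
    (hdiv : Divides φ b a) :
    ∃ b' : Fin l → (F.U : Filter ℕ).Product fun _ => N, SameTypeOver j a b' b ∧
      max 0 (F.approx.fineDim F.U (F.approx.trace (ultraEmbedding h hinj hrel) (solutionSet φ b'))) <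
        F.approx.fineDim F.U
          (F.approx.trace (ultraEmbedding h hinj hrel) (solutionSet ψ (j ∘ a))) := by
  classical
  obtain ⟨ga, hga⟩ := exists_rep_product (j ∘ a)
  let D : ∀ n, (Fin l → N) → Set (Fin k → F.approx.A n) := fun n y =>
    {x | (∀ i, x i ∈ F.approx.V n (Level.inf 0)) ∧ φ.Realize (Sum.elim (h n ∘ x) y)}
  let X : ∀ n, Set (Fin k → F.approx.A n) := fun n =>
    {x | (∀ i, x i ∈ F.approx.V n (Level.inf 0)) ∧
      ψ.Realize (Sum.elim (h n ∘ x) fun i => ga i n)}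
  obtain ⟨e, he⟩ := exists_surjective_nat (L.Formula (Fin m ⊕ Fin l))
  -- `χ` enumerates the complete type of `(a, b)`.
  let χ : ℕ → L.Formula (Fin m ⊕ Fin l) := fun i =>
    if (e i).Realize (Sum.elim a b) then e i else (e i).not
  have hχ : ∀ i, (χ i).Realize (Sum.elim a b) := by
    intro i
    simp only [χ]
    split_ifs with hi
    · exact hi
    · exact Formula.realize_not.2 hi
  obtain ⟨r, hr, hK⟩ := exists_inconsistent_tuples hdiv
  obtain ⟨b₁, hb₁⟩ := exists_diagonal F.nonprincipal (β := fun _ => Fin l → N)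
    (fun i n y => (χ i).Realize (Sum.elim (fun s => ga s n) y) ∧
      i * max 1 (D n y).ncard ≤ (X n).ncard) (fun C => by
    -- Besides a finite part of the type, `Γ` retains the inclusion in `ψ(x, a)`, so that the
    -- counting stays inside `X n`, and consistency, so that the maximum with `1` is harmless.
    let Γ : L.Formula (Fin m ⊕ Fin l) := (Formula.iInf fun i : Fin (C + 1) => χ i) ⊓
      ((inclusionFormula φ ψ).relabel Sum.swap ⊓
        Formula.iExs (Fin k) (φ.relabel (Sum.elim Sum.inr (Sum.inl ∘ Sum.inr))))
    have hΓ : ∀ (a : Fin m → N) (b : Fin l → N), Γ.Realize (Sum.elim a b) ↔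
        (∀ i : Fin (C + 1), (χ i).Realize (Sum.elim a b)) ∧
          solutionSet φ b ⊆ solutionSet ψ a ∧ (solutionSet φ b).Nonempty := by
      intro a b
      simp only [Γ, Formula.realize_inf, Formula.realize_iInf, Formula.realize_iExs,
        Formula.realize_relabel]
      refine and_congr_right fun _ => and_congr ?_ (exists_congr fun x => ?_)
      · rw [← realize_inclusionFormula]
        refine iff_of_eq (congrArg _ ?_)
        ext i
        rcases i with i | i <;> rfl
      · refine iff_of_eq (congrArg _ ?_)
        ext i
        rcases i with i | i <;> rfl
    -- With `(C + 1) * r` instances, averaging leaves one of size at most `|X n| / (C + 1)`, which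
    -- serves all `i ≤ C`.
    obtain ⟨t, htΓ, htinc⟩ := hK ((C + 1) * r) Γ ((hΓ a b).2 ⟨fun i => hχ i, himp, hne⟩)
    obtain ⟨η, hη⟩ := exists_inconsistency_formula.{u, v, w} φ ((C + 1) * r) r
    -- `j` need not be the diagonal embedding, so the representatives of tuples of `N` may vary with
    -- `n`, and their properties have to be recovered for almost all `n` from those in the
    -- ultrapower.
    obtain ⟨g, hg⟩ := exists_rep_product
      (fun p : Fin ((C + 1) * r) × Fin l => j (t p.1 p.2))
    have h1 : ∀ᶠ n in (F.U : Filter ℕ), ∀ i,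
        Γ.Realize (Sum.elim (fun s => ga s n) fun s => g (i, s) n) := by
      refine eventually_all.2 fun i => ?_
      have hM : Γ.Realize (Sum.elim (j ∘ a) (j ∘ t i)) := by
        rw [← Sum.comp_elim, j.map_formula]
        exact htΓ i
      have := (realize_iff_eventually Γ (f := Sum.elim ga fun s => g (i, s)) (by
        rintro (s | s)
        exacts [congrFun hga s, congrFun hg (i, s)])).1 hM
      refine this.mono fun n hn => ?_
      convert hn using 1
      ext s
      rcases s with s | s <;> rfl
    have h2 : ∀ᶠ n in (F.U : Filter ℕ), η.Realize (fun p => g p n) := by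
      refine (realize_iff_eventually η (congrFun hg)).1 ?_
      exact (j.map_formula η fun p => t p.1 p.2).2 ((hη N t).2 htinc)
    have h3 : ∀ᶠ n in (F.U : Filter ℕ), ∀ i, (D n fun s => g (i, s) n).Nonempty := by
      refine eventually_all.2 fun i => ?_
      have hint := F.approx.isInternalWith_trace h hinj hrel φ fun s => g (i, s)
      refine hint.nonempty_iff.1 ?_
      have := F.trace_solutionSet_nonempty _ j hj φ (t i) ((hΓ a (t i)).1 (htΓ i)).2.2
      rwa [show j ∘ t i = _ from funext fun s => congrFun hg (i, s)] at this
    have h4 : ∀ᶠ n in (F.U : Filter ℕ), ∃ y : Fin l → N, ∀ i ≤ C,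
        (χ i).Realize (Sum.elim (fun s => ga s n) y) ∧
          i * max 1 (D n y).ncard ≤ (X n).ncard := by
      filter_upwards [h1, h2, h3] with n hn1 hn2 hn3
      obtain ⟨i, hi⟩ := exists_mul_ncard_le (Nat.succ_pos C) hr (X n)
        (fun i => D n fun s => g (i, s) n)
        (fun i x hx => ⟨hx.1, ((hΓ _ _).1 (hn1 i)).2.1 hx.2⟩)
        (fun I hI ⟨x, hx⟩ => (hη N fun i s => g (i, s) n).1 hn2 I hI
          ⟨h n ∘ x, fun i hi => (hx i hi).2⟩)
      refine ⟨fun s => g (i, s) n, fun c hc => ⟨((hΓ _ _).1 (hn1 i)).1 ⟨c, by omega⟩, ?_⟩⟩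
      rw [max_eq_right ((Set.ncard_pos (Set.toFinite _)).2 (hn3 i))]
      exact (Nat.mul_le_mul_right _ (by omega)).trans hi
    refine ⟨fun n => if hn : ∃ y : Fin l → N, ∀ i ≤ C,
        (χ i).Realize (Sum.elim (fun s => ga s n) y) ∧
          i * max 1 (D n y).ncard ≤ (X n).ncard then hn.choose else b, ?_⟩
    filter_upwards [h4] with n hn
    rw [dif_pos hn]
    exact hn.choose_spec)
  let b' : Fin l → (F.U : Filter ℕ).Product fun _ => N := fun i =>
    ((fun n => b₁ n i : ℕ → N) : (F.U : Filter ℕ).Product fun _ => N)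
  have htype : ∀ i, (χ i).Realize (Sum.elim (j ∘ a) b') := by
    intro i
    refine (realize_iff_eventually (χ i) (f := Sum.elim ga fun s n => b₁ n s) (by
      rintro (s | s)
      exacts [congrFun hga s, rfl])).2 ((hb₁ i).mono fun n hn => ?_)
    convert hn.1 using 1
    ext s
    rcases s with s | s <;> rfl
  refine ⟨b', fun ξ => ?_, ?_⟩
  · obtain ⟨i, rfl⟩ := he ξ
    have hi := htype i
    rw [← Sum.comp_elim, j.map_formula]
    simp only [χ] at hi
    split_ifs at hi with hab
    · exact iff_of_true hi hab
    · exact iff_of_false (Formula.realize_not.1 hi) hab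
  · have hX := F.approx.isInternalWith_trace h hinj hrel ψ ga
    have hD := F.approx.isInternalWith_trace h hinj hrel φ fun s n => b₁ n s
    rw [hga]
    exact hD.max_fineDim_lt hX fun C => (hb₁ C).mono fun n hn => hn.2

end PseudofiniteEmbedding

open FirstOrder.Language

variable {L : FirstOrder.Language.{u, v}} {T : L.Theory}

theorem FiniteApproximation.exists_isInternalWith_trace [L.IsRelational]
    (S : FiniteApproximation T) {U : Ultrafilter ℕ} {N : Type w} [L.Structure N] [Nonempty N]
    (h : ∀ n, S.A n → N) (hinj : ∀ n, Function.Injective (h n))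
    (hrel : ∀ (s : ℕ) (R : L.Relations s), ∀ᶠ n in (U : Filter ℕ), ∀ x : Fin s → S.A n,
      Structure.RelMap R (h n ∘ x) ↔ Structure.RelMap R x) {k : ℕ}
    {A : Set ((U : Filter ℕ).Product fun _ => N)}
    {B : Set (Fin k → (U : Filter ℕ).Product fun _ => N)} (hB : A.Definable L B) :
    ∃ E, S.IsInternalWith U (S.trace (ultraEmbedding h hinj hrel) B) E := by
  obtain ⟨φ, rfl⟩ := Set.definable_iff_exists_formula_sum.1 hB
  obtain ⟨g, hg⟩ := exists_rep_product (fun a : A => a.1)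
  have e : {v : Fin k → (U : Filter ℕ).Product fun _ => N | φ.Realize (Sum.elim Subtype.val v)} =
      {y | (φ.relabel Sum.swap).Realize
        (Sum.elim y fun b => (g b : (U : Filter ℕ).Product fun _ => N))} := by
    ext y
    change φ.Realize _ ↔ (φ.relabel Sum.swap).Realize _
    refine Iff.trans (iff_of_eq (congrArg φ.Realize ?_)) Formula.realize_relabel.symm
    ext i
    rcases i with i | i
    exacts [congrFun hg i, rfl]
  rw [e]
  exact ⟨_, S.isInternalWith_trace h hinj hrel (φ.relabel Sum.swap) g⟩

/-! ### The trace dimension on definable sets. -/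

section Trace

variable (S : FiniteApproximation T) {U : Ultrafilter ℕ} {M : Type w} (H : S.Ultra U → M)

open Classical in
/-- The dimension of the set of points of `V_ω` that are mapped into `B`, and at least `0` if `B`
is nonempty. -/
noncomputable def traceDim {k : ℕ} (B : Set (Fin k → M)) : WithBot (FineGroup U) :=
  if B = ∅ then ⊥ else max 0 (S.fineDim U (S.trace H B))

variable {S H} {k : ℕ}

theorem traceDim_empty : traceDim S H (∅ : Set (Fin k → M)) = ⊥ := if_pos rfl

theorem traceDim_of_nonempty {B : Set (Fin k → M)} (hB : B.Nonempty) :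
    traceDim S H B = max 0 (S.fineDim U (S.trace H B)) := if_neg hB.ne_empty

theorem traceDim_le {B : Set (Fin k → M)} :
    traceDim S H B ≤ max 0 (S.fineDim U (S.trace H B)) := by
  rcases B.eq_empty_or_nonempty with rfl | hB
  · rw [traceDim_empty]; exact bot_le
  · exact (traceDim_of_nonempty hB).le

variable [L.Structure M] {A : Set M}

theorem traceDim_mono (hint : ∀ B : Set (Fin k → M), A.Definable L B →
      ∃ E, S.IsInternalWith U (S.trace H B) E)
    {B B' : Set (Fin k → M)} (hB : A.Definable L B) (hB' : A.Definable L B')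
    (h : B ⊆ B') : traceDim S H B ≤ traceDim S H B' := by
  rcases B.eq_empty_or_nonempty with rfl | hne
  · rw [traceDim_empty]; exact bot_le
  rw [traceDim_of_nonempty hne, traceDim_of_nonempty (hne.mono h)]
  obtain ⟨E, hE⟩ := hint B hB
  obtain ⟨E', hE'⟩ := hint B' hB'
  exact max_le_max le_rfl (hE.fineDim_mono hE' (FiniteApproximation.trace_mono h))

theorem traceDim_union_le (hint : ∀ B : Set (Fin k → M), A.Definable L B →
      ∃ E, S.IsInternalWith U (S.trace H B) E)
    {B B' : Set (Fin k → M)} (hB : A.Definable L B)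
    (hB' : A.Definable L B') :
    traceDim S H (B ∪ B') ≤ max (traceDim S H B) (traceDim S H B') := by
  rcases B.eq_empty_or_nonempty with rfl | hne
  · simp
  rcases B'.eq_empty_or_nonempty with rfl | hne'
  · simp
  rw [traceDim_of_nonempty hne, traceDim_of_nonempty hne',
    traceDim_of_nonempty (hne.mono Set.subset_union_left), FiniteApproximation.trace_union,
    ← max_max_max_comm, max_self]
  obtain ⟨E, hE⟩ := hint B hB
  obtain ⟨E', hE'⟩ := hint B' hB'
  exact max_le_max le_rfl (hE.fineDim_union_le hE')

/-- This supplies the covering condition of `exists_pointwise_dimension`: by monotonicity, finitely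
many sets of smaller dimension cannot cover a set of dimension `g`. -/
theorem definable_and_traceDim_sUnion_lt (hint : ∀ B : Set (Fin k → M), A.Definable L B →
      ∃ E, S.IsInternalWith U (S.trace H B) E)
    {g : WithBot (FineGroup U)} (hg : ⊥ < g)
    (F : Finset (Set (Fin k → M))) (hF : ∀ B ∈ F, A.Definable L B ∧ traceDim S H B < g) :
    A.Definable L (⋃₀ (F : Set (Set (Fin k → M)))) ∧
      traceDim S H (⋃₀ (F : Set (Set (Fin k → M)))) < g := by
  classical
  induction F using Finset.induction_on with
  | empty =>
    simp only [Finset.coe_empty, Set.sUnion_empty, traceDim_empty]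
    exact ⟨Set.definable_empty, hg⟩
  | insert B F hBF ih =>
    obtain ⟨h1, h2⟩ := ih fun B hB => hF B (Finset.mem_insert_of_mem hB)
    obtain ⟨h3, h4⟩ := hF B (Finset.mem_insert_self _ _)
    rw [Finset.coe_insert, Set.sUnion_insert]
    exact ⟨h3.union h1, (traceDim_union_le hint h3 h1).trans_lt (max_lt h4 h2)⟩

end Trace

/-! ### Extension to a quasidimension, and the inequality. -/

namespace PseudofiniteEmbedding

/-- The dimension on the sets definable over a countable set `A` extends to a quasidimension on the
ultrapower. -/
theorem exists_isQuasidimension_ultrapower [L.IsRelational] [Countable L.Symbols]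
    (S : FiniteApproximation T) {U : Ultrafilter ℕ} (hU : (U : Filter ℕ) ≤ cofinite)
    {N : Type w} [L.Structure N] [Nonempty N]
    (H : S.Ultra U → (U : Filter ℕ).Product fun _ => N)
    {A : Set ((U : Filter ℕ).Product fun _ => N)} (hA : A.Countable)
    (hint : ∀ (k : ℕ) (B : Set (Fin k → (U : Filter ℕ).Product fun _ => N)), A.Definable L B →
      ∃ E, S.IsInternalWith U (S.trace H B) E) :
    ∃ δ : ∀ k : ℕ, Set (Fin k → (U : Filter ℕ).Product fun _ => N) → WithBot (FineGroup U),
      IsQuasidimension L ((U : Filter ℕ).Product fun _ => N) δ ∧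
        ∀ k B, A.Definable L B → δ k B = traceDim S H B := by
  have hd := fun k : ℕ => exists_pointwise_dimension
    (E := Fin k → (U : Filter ℕ).Product fun _ => N) (z := (0 : WithBot (FineGroup U)))
    (FineGroup.exists_relative_inf hU)
    (ℬ := {B | A.Definable L B}) (𝒟 := {B | Set.univ.Definable L B})
    (countable_definable hA (Fin k)) Set.definable_univ
    (fun B hB => hB.mono (Set.subset_univ A)) (traceDim S H)
    (fun B hB hne => by rw [traceDim_of_nonempty hne]; exact le_max_left _ _)
    (fun B hB hne F hF hsub => by
      have hpos : ⊥ < traceDim S H B := by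
        rw [traceDim_of_nonempty hne]
        exact (WithBot.bot_lt_coe (0 : FineGroup U)).trans_le (le_max_left _ _)
      obtain ⟨h1, h2⟩ := definable_and_traceDim_sUnion_lt (hint k) hpos F hF
      exact absurd (traceDim_mono (hint k) hB h1 hsub) (not_le.2 h2))
    (fun X hX 𝓕 h𝓕 => not_subset_sUnion_of_countable hU hX
      ((countable_definable hA (Fin k)).mono h𝓕)
      fun B hB => (h𝓕 hB : A.Definable L B).mono (Set.subset_univ A))
  choose d hd0 hdmax hdB using hd
  obtain ⟨δ, hδ, hδempty, hδmax⟩ := exists_isQuasidimension d hd0 hdmax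
  refine ⟨δ, hδ, fun k B hB => ?_⟩
  rcases B.eq_empty_or_nonempty with rfl | hne
  · rw [hδempty, traceDim_empty]
  · obtain ⟨h1, p, hp, h2⟩ := hdB k B hB hne
    exact hδmax k B _ ⟨⟨p, hp, h2⟩, by rintro _ ⟨q, hq, rfl⟩; exact h1 q hq⟩

theorem exists_quasidimension_lt [L.IsRelational] [Countable L.Symbols] (hT : T.IsComplete)
    (hmc : IsModelComplete T) {N : Type w} [L.Structure N] [N ⊨ T] [Nonempty N] [Countable N]
    (F : PseudofiniteEmbedding T N) {k m l : ℕ}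
    (ψ : L.Formula (Fin k ⊕ Fin m)) (φ : L.Formula (Fin k ⊕ Fin l))
    (a : Fin m → N) (b : Fin l → N) (himp : solutionSet φ b ⊆ solutionSet ψ a)
    (hψ : (solutionSet ψ a).Nonempty) (hdiv : Divides φ b a) :
    ∃ (M : Type w) (_ : L.Structure M) (j : N ↪ₑ[L] M)
      (δ : ∀ n : ℕ, Set (Fin n → M) → WithBot (FineGroup F.U)),
      IsQuasidimension L M δ ∧
      (∀ (n r : ℕ) (θ : L.Formula (Fin n ⊕ Fin r)) (c : Fin r → N),
        δ n (solutionSet θ (j ∘ c)) = F.dim n (solutionSet θ c)) ∧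
      ∃ b' : Fin l → M, SameTypeOver j a b' b ∧
        δ k (solutionSet φ b') < δ k (solutionSet ψ (j ∘ a)) ∧
        δ k (solutionSet ψ (j ∘ a)) = F.dim k (solutionSet ψ a) := by
  obtain ⟨h, hinj, hrel⟩ := F.approx.exists_relation_preserving hT F.nonprincipal N
  let M := (F.U : Filter ℕ).Product fun _ => N
  have hMT : M ⊨ T := ultrapower_models
  let H : F.approx.Ultra F.U ↪[L] M := ultraEmbedding h hinj hrel
  let j : N ↪ₑ[L] M := elementaryOfIsModelComplete hmc
    (H.comp ((F.approx.belowOmega F.U).subtype.comp F.embed.toEmbedding))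
  have hj : ∀ x, j x = H (F.embed x) := fun x => rfl
  obtain ⟨b', hb', hlt⟩ : ∃ b' : Fin l → M, SameTypeOver j a b' b ∧
      (solutionSet φ b' = ∅ ∨ max 0 (F.approx.fineDim F.U (F.approx.trace H (solutionSet φ b'))) <
        F.approx.fineDim F.U (F.approx.trace H (solutionSet ψ (j ∘ a)))) := by
    rcases (solutionSet φ b).eq_empty_or_nonempty with hempty | hne
    -- If `φ(x, b)` has no solutions, `b` itself serves, with dimension `⊥`.
    · refine ⟨j ∘ b, fun χ => Iff.rfl, .inl ?_⟩
      rw [← Set.not_nonempty_iff_eq_empty] at hempty ⊢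
      rwa [solutionSet_nonempty_iff]
    · obtain ⟨b', h1, h2⟩ :=
        F.exists_conjugate_fineDim_lt h hinj hrel j hj ψ φ a b himp hne hdiv
      exact ⟨b', h1, .inr h2⟩
  -- Including `b'` among the parameters makes `δ` keep the trace dimension of `φ(x, b')` as well as
  -- the values of `δ_N`.
  obtain ⟨δ, hδ, hδA⟩ := exists_isQuasidimension_ultrapower F.approx F.nonprincipal H
    (A := Set.range j ∪ Set.range b') ((Set.countable_range j).union (Set.countable_range b'))
    (fun k B hB => F.approx.exists_isInternalWith_trace h hinj hrel hB)
  have hext : ∀ (n r : ℕ) (θ : L.Formula (Fin n ⊕ Fin r)) (c : Fin r → N),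
      δ n (solutionSet θ (j ∘ c)) = F.dim n (solutionSet θ c) := by
    intro n r θ c
    have hdef : (Set.range j ∪ Set.range b').Definable L (solutionSet θ (j ∘ c)) :=
      definable_solutionSet _ _ fun i => .inl ⟨c i, rfl⟩
    rw [hδA n _ hdef, F.dim_solutionSet hmc H j hj θ c]
    rcases (solutionSet θ c).eq_empty_or_nonempty with hempty | hne
    · have : solutionSet θ (j ∘ c) = ∅ := by
        rw [← Set.not_nonempty_iff_eq_empty] at hempty ⊢
        rwa [solutionSet_nonempty_iff]
      rw [this, traceDim_empty]
      have : F.approx.trace H (∅ : Set (Fin n → M)) = ∅ := by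
        ext x; exact ⟨fun hx => hx.2, fun hx => hx.elim⟩
      rw [this, FiniteApproximation.fineDim_empty]
    · rw [traceDim_of_nonempty ((solutionSet_nonempty_iff j θ c).2 hne)]
      obtain ⟨E, hE⟩ := F.approx.exists_isInternalWith_trace h hinj hrel hdef
      exact max_eq_right (hE.fineDim_nonneg (F.trace_solutionSet_nonempty H j hj θ c hne))
  refine ⟨M, inferInstance, j, δ, hδ, hext, b', hb', ?_, hext k m ψ a⟩
  have hψM : (solutionSet ψ (j ∘ a)).Nonempty := (solutionSet_nonempty_iff j ψ a).2 hψ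
  rw [hδA k _ (definable_solutionSet φ b' fun i => .inr ⟨i, rfl⟩),
    hδA k _ (definable_solutionSet ψ (j ∘ a) fun i => .inl ⟨a i, rfl⟩),
    traceDim_of_nonempty hψM]
  rcases hlt with hempty | hlt
  · rw [hempty, traceDim_empty]
    exact (WithBot.bot_lt_coe (0 : FineGroup F.U)).trans_le (le_max_left _ _)
  · exact (traceDim_le.trans_lt hlt).trans_le (le_max_right _ _)

end PseudofiniteEmbedding

open FirstOrder.Language

variable {L : FirstOrder.Language.{u, v}} {T : L.Theory}

/-! ### Existence of finite approximations and of the embedding. -/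

section Existence

theorem exists_embedding_modelType (N : Type) [L.Structure N] [N ⊨ T] [Nonempty N] :
    ∃ P : Theory.ModelType.{u, v, max u v} T, Nonempty (N ↪[L] P) := by
  let P : Theory.ModelType.{u, v, max u v} T :=
    (Theory.ModelType.of T N).equivInduced (Equiv.ulift.{max u v, 0}.symm : N ≃ ULift.{max u v} N)
  let e : N ≃[L] P := Equiv.inducedStructureEquiv (L := L)
    (Equiv.ulift.{max u v, 0}.symm : N ≃ ULift.{max u v} N)
  exact ⟨P, ⟨e.toEmbedding⟩⟩

/-- A finite set `F` of witnesses: if `∃ y, φ(c, y)` holds in some model that extends a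
substructure containing `F` and `c`, then it has a solution in `F`. -/
theorem exists_witnesses [L.IsRelational] (hmc : IsModelComplete T) {N : Type} [L.Structure N]
    [N ⊨ T] [Nonempty N] (t : Task L) (c : Fin t.p → N) :
    ∃ F : Finset N, ∀ (A : L.Substructure N) (c' : Fin t.p → A), (∀ i, (c' i : N) = c i) →
      (∀ x ∈ F, x ∈ A) →
      ∀ (P : Theory.ModelType.{u, v, max u v} T) (ι : A ↪[L] P) (d : Fin t.q → P),
        t.φ.Realize (Sum.elim (ι ∘ c') d) →
        ∃ d : Fin t.q → N, (∀ i, d i ∈ F) ∧ t.φ.Realize (Sum.elim c d) := by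
  classical
  -- If `∃ y, φ(c, y)` fails in `N`, then `F` witnesses its negation, which is existential modulo
  -- `T`; every model of `T` extending a substructure that contains `F` and `c` inherits the
  -- negation, so the hypothesis on `P` is void.
  by_cases h : ∃ d : Fin t.q → N, t.φ.Realize (Sum.elim c d)
  · obtain ⟨d, hd⟩ := h
    exact ⟨Finset.univ.image d, fun _ _ _ _ _ _ _ _ => ⟨d, fun i => by simp, hd⟩⟩
  · obtain ⟨q, θ, hθ, hT⟩ := exists_isQF_of_isModelComplete hmc (t.φ.iExs (Fin t.q)).not
    obtain ⟨z, hz⟩ := (realize_iff_exists_of_models hT N c).1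
      (Formula.realize_not.2 (by rwa [Formula.realize_iExs]))
    refine ⟨Finset.univ.image z, fun A c' hc' hA P ι d hd => ?_⟩
    let z' : Fin q → A := fun i => ⟨z i, hA _ (by simp)⟩
    have h1 : θ.Realize (Sum.elim c' z') := by
      rw [← realize_iff_of_isQF hθ A.subtype, Sum.comp_elim,
        show A.subtype ∘ c' = c from funext hc']
      exact hz
    have h2 : θ.Realize (Sum.elim (ι ∘ c') (ι ∘ z')) := by
      rwa [← Sum.comp_elim, realize_iff_of_isQF hθ ι]
    have h3 := (realize_iff_exists_of_models hT P _).2 ⟨_, h2⟩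
    rw [Formula.realize_not, Formula.realize_iExs] at h3
    exact absurd ⟨d, hd⟩ h3

/-- The position of a level in the finite chain that remains when `ω` is cut off at `J`. -/
def Level.rank (J : ℕ) (α : Level) : ℕ :=
  Sum.elim (fun j => min j J) (fun j => J + min j J) (ofLex α)

/-- The number `n` for the levels `n` and `ω + n`. -/
def Level.index (α : Level) : ℕ := Sum.elim id id (ofLex α)

theorem Level.rank_mono (J : ℕ) : Monotone (Level.rank J) := by
  intro α β h
  induction α using Lex.rec with | _ α
  induction β using Lex.rec with | _ β
  rcases α with i | i <;> rcases β with j | j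
  · have := Sum.Lex.inl_le_inl_iff.1 h
    exact min_le_min_right J this
  · exact (min_le_right _ _).trans (Nat.le_add_right _ _)
  · exact absurd h Sum.Lex.not_inr_le_inl
  · have := Sum.Lex.inr_le_inr_iff.1 h
    exact Nat.add_le_add_left (min_le_min_right J this) J

theorem Level.rank_le (J : ℕ) (α : Level) : Level.rank J α ≤ 2 * J := by
  rcases α with i | i
  · change min i J ≤ 2 * J; omega
  · change J + min i J ≤ 2 * J; omega

theorem Level.rank_next {J : ℕ} {α : Level} (h : α.index < J) :
    Level.rank J α.next = Level.rank J α + 1 := by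
  rcases α with i | i
  · change i < J at h
    change min (i + 1) J = min i J + 1; omega
  · change i < J at h
    change J + min (i + 1) J = J + min i J + 1; omega

theorem countable_task [Countable L.Symbols] : Countable (Task L) := by
  let f : Task L → (Σ p : ℕ × ℕ, L.Formula (Fin p.1 ⊕ Fin p.2)) × (ℕ ⊕ ℕ) :=
    fun t => (⟨(t.p, t.q), t.φ⟩, ofLex t.level)
  refine Function.Injective.countable (f := f) ?_
  rintro ⟨p, q, φ, hφ, α⟩ ⟨p', q', φ', hφ', α'⟩ h
  simp only [f, Prod.mk.injEq, Sigma.mk.injEq] at h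
  obtain ⟨⟨⟨rfl, rfl⟩, h2⟩, h3⟩ := h
  obtain rfl := eq_of_heq h2
  obtain rfl := ofLex.injective h3
  rfl

theorem exists_task_enumeration [Countable L.Symbols] :
    ∃ task : ℕ → Task L, ∀ t, {i | task i = t}.Infinite := by
  have := countable_task (L := L)
  have : Nonempty (Task L) := ⟨⟨0, 0, ⊥, BoundedFormula.isQF_bot, Level.fin 0⟩⟩
  obtain ⟨e, he⟩ := exists_surjective_nat (Task L)
  refine ⟨fun i => e (Nat.unpair i).1, fun t => ?_⟩
  obtain ⟨i, rfl⟩ := he t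
  refine (Set.infinite_range_of_injective (f := fun k => Nat.pair i k) fun k k' h => ?_).mono ?_
  · exact (Nat.pair_eq_pair.1 h).2
  · rintro _ ⟨k, rfl⟩
    simp

/-- A countable model of a model complete theory is approximated by its finite substructures. -/
theorem exists_finiteApproximation [L.IsRelational] [Countable L.Symbols]
    (hmc : IsModelComplete T) (N : Type) [L.Structure N] [N ⊨ T] [Nonempty N] [Countable N] :
    ∃ (S : FiniteApproximation T) (h : ∀ n, S.A n ↪[L] N),
      ∀ x : N, ∀ᶠ n in atTop, ∃ y ∈ S.V n (Level.fin 0), h n y = x := by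
  classical
  obtain ⟨task, htask⟩ := exists_task_enumeration (L := L)
  obtain ⟨e, he⟩ := exists_surjective_nat N
  choose wit hwit using fun (t : Task L) (c : Fin t.p → N) => exists_witnesses hmc t c
  let cl : ℕ → Finset N → Finset N := fun n W => W ∪ (Finset.range n).biUnion fun i =>
    (Fintype.piFinset fun _ : Fin (task i).p => W).biUnion (wit (task i))
  -- `J n` exceeds the index of the level of each of the first `n` tasks, so cutting off at `J n`
  -- does not identify such a level with its successor.
  let J : ℕ → ℕ := fun n => (Finset.range n).sup fun i => (task i).level.index + 1
  let W : ℕ → ℕ → Finset N := fun n s => (cl n)^[s] ((Finset.range (n + 1)).image e)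
  have hW_succ : ∀ n s, W n (s + 1) = cl n (W n s) := fun n s =>
    Function.iterate_succ_apply' _ _ _
  have hW_mono : ∀ n, Monotone (W n) := fun n => monotone_nat_of_le_succ fun s => by
    rw [hW_succ]
    exact Finset.subset_union_left
  have hW_wit : ∀ n s i, i < n → ∀ c : Fin (task i).p → N, (∀ r, c r ∈ W n s) →
      wit (task i) c ⊆ W n (s + 1) := by
    intro n s i hi c hc x hx
    rw [hW_succ]
    refine Finset.mem_union_right _ (Finset.mem_biUnion.2 ⟨i, Finset.mem_range.2 hi,
      Finset.mem_biUnion.2 ⟨c, ?_, hx⟩⟩)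
    exact Fintype.mem_piFinset.2 hc
  -- All ranks are at most `2 * J n`; one further closure step leaves room for the witnesses at
  -- every rank.
  let A : ℕ → L.Substructure N := fun n =>
    { carrier := W n (2 * J n + 1)
      fun_mem := fun f => isEmptyElim f }
  have he0 : ∀ n i, i ≤ n → ∀ s, e i ∈ W n s := fun n i hi s => by
    refine hW_mono n (Nat.zero_le s) ?_
    exact Finset.mem_image.2 ⟨i, by simp; omega, rfl⟩
  obtain ⟨P, ⟨κ⟩⟩ := exists_embedding_modelType (T := T) N
  have hfinite : ∀ n, Finite (A n) := fun n => (W n (2 * J n + 1)).finite_toSet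
  let S : FiniteApproximation T :=
    { A := fun n => A n
      finite := hfinite
      nonempty := fun n => ⟨⟨e 0, he0 n 0 (Nat.zero_le n) _⟩⟩
      V := fun n α => {x | x.1 ∈ W n (Level.rank (J n) α)}
      V_mono := fun n α β h x hx => hW_mono n (Level.rank_mono _ h) hx
      task := task
      task_infinite := htask
      extends_to_model := fun n => ⟨P, ⟨κ.comp (A n).subtype⟩⟩
      strong := by
        rintro n i hi c hc ⟨P, ι, d, hd⟩
        have hJ : (task i).level.index < J n := Nat.lt_of_succ_le
          (Finset.le_sup (f := fun i => (task i).level.index + 1) (Finset.mem_range.2 hi))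
        have hsub := hW_wit n _ i hi (fun r => (c r).1) hc
        have hle : Level.rank (J n) (task i).level + 1 ≤ 2 * J n + 1 :=
          Nat.succ_le_succ (Level.rank_le _ _)
        obtain ⟨d', hd'F, hd'⟩ := hwit (task i) (fun r => (c r).1) (A n) c (fun _ => rfl)
          (fun x hx => hW_mono n hle (hsub hx)) P ι d hd
        refine ⟨fun r => ⟨d' r, hW_mono n hle (hsub (hd'F r))⟩, fun r => ?_, ?_⟩
        · change d' r ∈ W n (Level.rank (J n) (task i).level.next)
          rw [Level.rank_next hJ]
          exact hsub (hd'F r)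
        · rw [← realize_iff_of_isQF (task i).isQF (A n).subtype, Sum.comp_elim]
          exact hd' }
  refine ⟨S, fun n => (A n).subtype, fun x => ?_⟩
  obtain ⟨i, rfl⟩ := he x
  filter_upwards [eventually_ge_atTop i] with n hn
  exact ⟨⟨e i, he0 n i hn _⟩, he0 n i hn (Level.rank (J n) (Level.fin 0)), rfl⟩

/-- The substructure `V_{<ω}` is elementary in a model of `T` that is an ultrapower. -/
theorem realize_belowOmega_iff [L.IsRelational] (hmc : IsModelComplete T) {N : Type}
    [L.Structure N] [N ⊨ T] [Nonempty N] (S : FiniteApproximation T) {U : Ultrafilter ℕ}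
    (hU : (U : Filter ℕ) ≤ cofinite) (h : ∀ n, S.A n ↪[L] N) {n : ℕ} (χ : L.Formula (Fin n))
    (x : Fin n → S.belowOmega U) :
    χ.Realize (fun i => ultraEmbedding (U := U) (fun n => h n) (fun n => (h n).injective)
      (fun _ R => Eventually.of_forall fun n x => (h n).map_rel R x) (x i : S.Ultra U)) ↔
      χ.Realize x := by
  classical
  let H : S.Ultra U ↪[L] (U : Filter ℕ).Product fun _ => N :=
    ultraEmbedding (U := U) (fun n => h n) (fun n => (h n).injective)
      (fun _ R => Eventually.of_forall fun n x => (h n).map_rel R x)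
  -- The test of Tarski and Vaught: an element `a` of the ultrapower has to be replaced by one of
  -- `V_{<ω}`.
  refine Embedding.isElementary_of_exists (H.comp (S.belowOmega U).subtype) ?_ χ x
  clear x χ n
  intro n φ x a ha
  let χ : L.Formula (Fin (n + 1)) := φ.toFormula.relabel (Sum.elim Empty.elim id)
  have hχ : ∀ {Q : Type} [L.Structure Q] (y : Fin (n + 1) → Q),
      χ.Realize y ↔ φ.Realize default y := by
    intro Q _ y
    simp only [χ, Formula.realize_relabel, BoundedFormula.realize_toFormula]
    refine iff_of_eq (congrArg₂ _ (Subsingleton.elim _ _) ?_)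
    ext i
    rfl
  rw [← hχ] at ha
  obtain ⟨q, θ, hθ, hT⟩ := exists_isQF_of_isModelComplete hmc χ
  -- The element sought moves from the parameters to the front of the witnesses, so that strong
  -- satisfaction finds it together with the witnesses of `θ`, one level above the parameters.
  let ρ : Fin (n + 1) ⊕ Fin q → Fin n ⊕ Fin (q + 1) :=
    Sum.elim (Fin.snoc (α := fun _ => Fin n ⊕ Fin (q + 1)) Sum.inl (Sum.inr 0))
      fun s => Sum.inr s.succ
  have hρ : ∀ (c : Fin n → N) (y : N) (z : Fin q → N),
      Sum.elim c (Fin.cons (α := fun _ => N) y z) ∘ ρ =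
        Sum.elim (Fin.snoc (α := fun _ => N) c y) z := by
    intro c y z
    ext i
    rcases i with i | i
    · refine Fin.lastCases ?_ (fun i => ?_) i <;> simp [ρ]
    · simp [ρ]
  let η : L.Formula (Fin n ⊕ Fin (q + 1)) := θ.relabel ρ
  have hη : η.IsQF := hθ.relabel _
  have hηr : ∀ (c : Fin n → N) (y : N) (z : Fin q → N),
      η.Realize (Sum.elim c (Fin.cons (α := fun _ => N) y z)) ↔
        θ.Realize (Sum.elim (Fin.snoc (α := fun _ => N) c y) z) := fun c y z => by
    rw [← hρ]
    exact Formula.realize_relabel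
  obtain ⟨J, hJ⟩ : ∃ J, ∀ i, (x i : S.Ultra U) ∈ S.ultraV U (Level.fin J) := by
    choose j hj using fun i => (x i).2
    exact ⟨Finset.univ.sup j, fun i =>
      S.ultraV_mono (Sum.Lex.inl_le_inl_iff.2 (Finset.le_sup (Finset.mem_univ i))) (hj i)⟩
  obtain ⟨f, hf⟩ := exists_rep_product (fun i => (x i : S.Ultra U))
  obtain ⟨g, hg⟩ := exists_rep_product (fun _ : Unit => a)
  obtain ⟨P, ⟨κ⟩⟩ := exists_embedding_modelType (T := T) N
  have hcast : ∀ (y : ℕ → N) (b : (U : Filter ℕ).Product fun _ => N),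
      b = (y : (U : Filter ℕ).Product fun _ => N) →
      (χ.Realize (Fin.snoc (H.comp (S.belowOmega U).subtype ∘ x) b : Fin (n + 1) → _) ↔
        ∀ᶠ r in (U : Filter ℕ),
          χ.Realize (Fin.snoc (fun i => h r (f i r)) (y r) : Fin (n + 1) → N)) := by
    intro y b hyb
    refine (realize_iff_eventually χ
      (f := Fin.snoc (α := fun _ => ℕ → N) (fun i r => h r (f i r)) y) fun i => ?_).trans
      (eventually_congr (Eventually.of_forall fun r => iff_of_eq (congrArg _ ?_)))
    · refine Fin.lastCases ?_ (fun i => ?_) i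
      · simp only [Fin.snoc_last]
        exact hyb
      · simp only [Fin.snoc_castSucc]
        exact congrArg H (congrFun hf i)
    · ext i
      refine Fin.lastCases ?_ (fun i => ?_) i
      · simp only [Fin.snoc_last]
      · simp only [Fin.snoc_castSucc]
  have h1 := (hcast _ _ (congrFun hg ())).1 ha
  have h2 : ∀ᶠ r in (U : Filter ℕ), ∀ i, f i r ∈ S.V r (Level.fin J) :=
    eventually_all.2 fun i => S.coe_mem_ultraV.1 (congrFun hf i ▸ hJ i)
  have h3 := S.eventually_stronglySatisfies hU η hη (Level.fin J)
  have h4 : ∀ᶠ r in (U : Filter ℕ), ∃ y ∈ S.V r (Level.fin (J + 1)),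
      χ.Realize (Fin.snoc (fun i => h r (f i r)) (h r y) : Fin (n + 1) → N) := by
    filter_upwards [h1, h2, h3] with r hr1 hr2 hr3
    obtain ⟨z, hz⟩ := (realize_iff_exists_of_models hT N _).1 hr1
    obtain ⟨d, hdV, hd⟩ := hr3 (fun i => f i r) hr2
      ⟨P, κ.comp (h r), κ ∘ Fin.cons (α := fun _ => N) (g () r) z, by
        have := realize_iff_of_isQF hη κ
          (Sum.elim (fun i => h r (f i r)) (Fin.cons (α := fun _ => N) (g () r) z))
        rw [Sum.comp_elim] at this
        exact this.2 ((hηr _ _ _).2 hz)⟩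
    refine ⟨d 0, hdV 0, (realize_iff_exists_of_models hT N _).2 ⟨fun s => h r (d s.succ), ?_⟩⟩
    have hd' := (realize_iff_of_isQF hη (h r) _).2 hd
    have e : (h r ∘ Sum.elim (fun i => f i r) d) = Sum.elim (fun i => h r (f i r))
        (Fin.cons (α := fun _ => N) (h r (d 0)) fun s => h r (d s.succ)) := by
      rw [Sum.comp_elim]
      congr 1
      ext s
      refine Fin.cases ?_ (fun s => ?_) s <;> simp
    rw [e] at hd'
    exact (hηr _ _ _).1 hd'
  let b : ∀ r, S.A r := fun r => if hr : ∃ y ∈ S.V r (Level.fin (J + 1)),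
      χ.Realize (Fin.snoc (fun i => h r (f i r)) (h r y) : Fin (n + 1) → N) then hr.choose
    else Classical.arbitrary _
  have hb : ∀ᶠ r in (U : Filter ℕ), b r ∈ S.V r (Level.fin (J + 1)) ∧
      χ.Realize (Fin.snoc (fun i => h r (f i r)) (h r (b r)) : Fin (n + 1) → N) := by
    filter_upwards [h4] with r hr
    simp only [b, dif_pos hr]
    exact hr.choose_spec
  refine ⟨⟨(b : S.Ultra U), J + 1, b, rfl, hb.mono fun r hr => hr.1⟩, ?_⟩
  rw [← hχ]
  exact (hcast (fun r => h r (b r)) _ rfl).2 (hb.mono fun r hr => hr.2)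

/-- Every countable model of `T` embeds elementarily into `V_{<ω}` of an ultraproduct of finite
approximations. -/
theorem nonempty_pseudofiniteEmbedding [L.IsRelational] [Countable L.Symbols]
    (hmc : IsModelComplete T) (N : Type w) [L.Structure N] [N ⊨ T] [Nonempty N] [Countable N] :
    Nonempty (PseudofiniteEmbedding T N) := by
  classical
  -- Finite approximations consist of structures in `Type`, so `N` is first replaced by a copy on a
  -- subset of `ℕ`.
  obtain ⟨f, hf⟩ := exists_injective_nat N
  let q : N ≃ Set.range f := Equiv.ofInjective f hf
  let _ : L.Structure (Set.range f) := q.inducedStructure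
  let e : N ≃[L] Set.range f := q.inducedStructureEquiv
  have hT : Set.range f ⊨ T := StrongHomClass.theory_model e
  have : Nonempty (Set.range f) := q.symm.nonempty
  obtain ⟨S, h, hS⟩ := exists_finiteApproximation hmc (Set.range f)
  let U : Ultrafilter ℕ := hyperfilter ℕ
  have hU : (U : Filter ℕ) ≤ cofinite := hyperfilter_le_cofinite
  let γ : N → ∀ n, S.A n := fun x n =>
    if hx : ∃ y ∈ S.V n (Level.fin 0), h n y = e x then hx.choose else Classical.arbitrary _
  have hγ : ∀ x, ∀ᶠ n in (U : Filter ℕ), γ x n ∈ S.V n (Level.fin 0) ∧ h n (γ x n) = e x := by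
    intro x
    rw [Nat.cofinite_eq_atTop] at hU
    filter_upwards [hU (hS (e x))] with n hn
    simp only [γ, dif_pos hn]
    exact hn.choose_spec
  refine ⟨⟨S, U, hU, ⟨fun x => ⟨(γ x : S.Ultra U), 0, γ x, rfl, (hγ x).mono fun n hn => hn.1⟩,
    fun n χ x => ?_⟩⟩⟩
  -- Followed by the map to the ultrapower, `γ` becomes the diagonal embedding, which is elementary
  -- by Łoś's theorem.
  rw [← realize_belowOmega_iff hmc S hU h]
  refine (realize_iff_eventually χ (f := fun i _ => e (x i)) fun i =>
    coe_product_eq_coe.2 ((hγ (x i)).mono fun n hn => hn.2)).trans ?_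
  rw [eventually_const]
  exact StrongHomClass.realize_formula e χ

end Existence

end FineDimension

theorem mainTheorem1 {L : FirstOrder.Language.{u, v}} [L.IsRelational] [Countable L.Symbols]
    (T : L.Theory) (hT : T.IsComplete) (hmc : FineDimension.IsModelComplete T)
    (N : Type w) [L.Structure N] [N ⊨ T] [Nonempty N] [Countable N] :
    Nonempty (FineDimension.PseudofiniteEmbedding T N) ∧
    ∀ (F : FineDimension.PseudofiniteEmbedding T N) (k m l : ℕ)
      (ψ : L.Formula (Fin k ⊕ Fin m)) (φ : L.Formula (Fin k ⊕ Fin l))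
      (a : Fin m → N) (b : Fin l → N),
      ψ.IsExistential → φ.IsExistential →
      FineDimension.solutionSet φ b ⊆ FineDimension.solutionSet ψ a →
      (FineDimension.solutionSet ψ a).Nonempty →
      FineDimension.Divides φ b a →
      ∃ (M : Type w) (_ : L.Structure M) (j : N ↪ₑ[L] M)
        (δ : ∀ n : ℕ, Set (Fin n → M) → WithBot (FineDimension.FineGroup F.U)),
        FineDimension.IsQuasidimension L M δ ∧
        (∀ (n r : ℕ) (θ : L.Formula (Fin n ⊕ Fin r)) (c : Fin r → N),
          δ n (FineDimension.solutionSet θ (j ∘ c)) =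
            F.dim n (FineDimension.solutionSet θ c)) ∧
        ∃ b' : Fin l → M, FineDimension.SameTypeOver j a b' b ∧
          δ k (FineDimension.solutionSet φ b') < δ k (FineDimension.solutionSet ψ (j ∘ a)) ∧
          δ k (FineDimension.solutionSet ψ (j ∘ a)) =
            F.dim k (FineDimension.solutionSet ψ a) :=
  ⟨FineDimension.nonempty_pseudofiniteEmbedding hmc N,
    fun F _ _ _ ψ φ a b _ _ himp hne hdiv =>
      F.exists_quasidimension_lt hT hmc ψ φ a b himp hne hdiv⟩
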